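/- Let $\mathcal K$ be the triangulated infinite cylinder with vertex set $\mathbb Z/3\times\mathbb Z$ whose simplices are the subsets of the triangles $\{(l,n),(l,n+1),(l+1,n+1)\}$ and $\{(l,n),(l+1,n+1),(l+1,n)\}$, $l\in\mathbb Z/3$, $n\in\mathbb Z$. For $q\in\{1,2\}$ let $K_q$ be the set of oriented $q$-simplices (sequences of $q+1$ distinct vertices spanning a simplex, modulo even permutations); write $[\tau]$ for the simplex underlying $\tau$. Two $q$-simplices are down neighbors if they intersect in a $(q-1)$-simplex; $E_q$ is the set of pairs $(\tau,\tau')\in K_q\times K_q$ with $[\tau],[\tau']$ down neighbors, and $\deg\tau$ is the number of (unoriented) $q$-simplices that are down neighbors of $[\tau]$. For $(\tau,\tau')\in E_q$ put $\eta(\tau,\tau')=\operatorname{sgn}(\tau,\mu)\operatorname{sgn}(\tau',\mu)$, where $\mu\in K_{q-1}$ is $[\tau]\cap[\tau']$ with any orientation and $\operatorname{sgn}(\langle a_0\cdots a_q\rangle,\langle a_0\cdots\widehat{a_j}\cdots a_q\rangle)=(-1)^j$. Define $$d_q:\ell^2(E_q)\to\ell^2(K_q),\quad (d_q g)(\tau)=\frac1{\sqrt{2\deg\tau}}\sum_{\tau':(\tau,\tau')\in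 E_q}g(\tau,\tau'),\qquad (S_q g)(\tau,\tau')=\eta(\tau,\tau')\,g(\tau',\tau),$$ the down-Grover walk $U_q^{\rm down}=S_q(2d_q^*d_q-I)$ on $\ell^2(E_q)$ and its discriminant $D_q^{\rm down}=d_qS_qd_q^*$ on $\ell^2(K_q)$ (complex Hilbert spaces). The continuous spectrum of a bounded operator $T$ is the set of those $\lambda$ in its spectrum that are not eigenvalues and for which $T-\lambda$ has dense range. Then the following hold. 1. $\operatorname{Spec}(D_2^{\rm down})=[-1,1]$; the continuous spectrum is $[-1,1]\setminus\{0\}$, and $0$ is the only eigenvalue. Moreover $\operatorname{Spec}(U_2^{\rm down})=S^1$; every point of $S^1\setminus\{\pm i,\pm1\}$ belongs to the continuous spectrum, and $\pm i$ are eigenvalues of $U_2^{\rm down}$. 2. $\operatorname{Spec}(D_1^{\rm down})=\{-\tfrac15,0\}\cup(-\tfrac15,\tfrac7{10}]$; the continuous spectrum is $(-\tfrac15,\tfrac7{10}]\setminus\{0\}$, and the eigenvalues are exactly $-\tfrac15$ and $0$. The eigenvalue $0$ is also a point of the continuous part in the sense that the range of $D_1^{\rm down}$ is not closed. Moreover,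 with $A=\{\lambda\in S^1:\operatorname{Re}\lambda\in\{-\tfrac15,0\}\cup(-\tfrac15,\tfrac7{10}]\}$, one has $A\subseteq\operatorname{Spec}(U_1^{\rm down})\subseteq A\cup\{1,-1\}$. A point $\lambda\in S^1$ belongs to the continuous spectrum of $U_1^{\rm down}$ if $\operatorname{Re}\lambda\in(-\tfrac15,\tfrac7{10}]\setminus\{0\}$, and is an eigenvalue if $\operatorname{Re}\lambda\in\{-\tfrac15,0\}$; for $\lambda=\pm i$ the range of $U_1^{\rm down}-\lambda$ is, in addition, not closed. -/

import Mathlib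

noncomputable section

namespace DownWalk

/-! ### Ordered and oriented simplices -/

section Simplices

/-- An ordered `q`-simplex of `K`: a sequence `(a_0, ..., a_q)` of distinct vertices whose
underlying set is a face of `K`. -/
structure OrderedSimplex {V : Type*} (K : AbstractSimplicialComplex V) (q : ℕ) where
  vertex : Fin (q + 1) → V
  injective : Function.Injective vertex
  mem : Finset.univ.map ⟨vertex, injective⟩ ∈ K.faces

namespace OrderedSimplex

/-- The underlying set of vertices of an ordered simplex. -/
def support {V : Type*} {K : AbstractSimplicialComplex V} {q : ℕ} (s : OrderedSimplex K q) :
    Finset V :=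
  Finset.univ.map ⟨s.vertex, s.injective⟩

theorem mem_support {V : Type*} {K : AbstractSimplicialComplex V} {q : ℕ}
    (s : OrderedSimplex K q) (v : V) : v ∈ s.support ↔ ∃ i, s.vertex i = v := by
  simp [support]

/-- The ordered simplex `(a_{π 0}, ..., a_{π q})`. -/
def perm {V : Type*} {K : AbstractSimplicialComplex V} {q : ℕ} (s : OrderedSimplex K q)
    (π : Equiv.Perm (Fin (q + 1))) : OrderedSimplex K q where
  vertex := s.vertex ∘ π
  injective := s.injective.comp π.injective
  mem := by
    have h : Finset.univ.map ⟨s.vertex ∘ π, s.injective.comp π.injective⟩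
        = Finset.univ.map ⟨s.vertex, s.injective⟩ := by
      ext v
      simp only [Finset.mem_map, Finset.mem_univ, true_and, Function.Embedding.coeFn_mk,
        Function.comp_apply]
      exact ⟨fun ⟨i, hi⟩ => ⟨π i, hi⟩, fun ⟨i, hi⟩ => ⟨π.symm i, by simpa using hi⟩⟩
    rw [h]
    exact s.mem

/-- The face `(a_0, ..., â_j, ..., a_{q+1})` of an ordered `(q+1)`-simplex. -/
def face {V : Type*} {K : AbstractSimplicialComplex V} {q : ℕ} (s : OrderedSimplex K (q + 1))
    (j : Fin (q + 2)) : OrderedSimplex K q where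
  vertex := s.vertex ∘ j.succAbove
  injective := s.injective.comp Fin.succAbove_right_injective
  mem := by
    refine (K.isRelLowerSet_faces s.mem).2 ?_ ?_
    · intro v hv
      simp only [Finset.mem_map, Finset.mem_univ, true_and, Function.Embedding.coeFn_mk,
        Function.comp_apply] at hv ⊢
      obtain ⟨i, hi⟩ := hv
      exact ⟨_, hi⟩
    · simp

theorem ext_vertex {V : Type*} {K : AbstractSimplicialComplex V} {q : ℕ}
    {s t : OrderedSimplex K q} (h : s.vertex = t.vertex) : s = t := by
  cases s; cases t; cases h; rfl

theorem support_perm {V : Type*} {K : AbstractSimplicialComplex V} {q : ℕ}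
    (s : OrderedSimplex K q) (π : Equiv.Perm (Fin (q + 1))) : (s.perm π).support = s.support := by
  ext v
  simp only [mem_support, perm, Function.comp_apply]
  exact ⟨fun ⟨i, hi⟩ => ⟨π i, hi⟩, fun ⟨i, hi⟩ => ⟨π.symm i, by simpa using hi⟩⟩

/-- Two ordered simplices define the same orientation if they differ by an even permutation. -/
instance setoid {V : Type*} (K : AbstractSimplicialComplex V) (q : ℕ) :
    Setoid (OrderedSimplex K q) where
  r s t := ∃ π : Equiv.Perm (Fin (q + 1)), Equiv.Perm.sign π = 1 ∧ t = s.perm π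
  iseqv :=
    { refl := fun s => ⟨1, by simp, ext_vertex rfl⟩
      symm := by
        rintro s _ ⟨π, hπ, rfl⟩
        refine ⟨π⁻¹, by simp [hπ], ext_vertex ?_⟩
        ext i
        simp [perm]
      trans := by
        rintro s _ _ ⟨π, hπ, rfl⟩ ⟨ρ, hρ, rfl⟩
        exact ⟨π * ρ, by simp [hπ, hρ], ext_vertex rfl⟩ }

end OrderedSimplex

/-- Oriented `q`-simplices: ordered `q`-simplices modulo the alternating group. -/
def OrientedSimplex {V : Type*} (K : AbstractSimplicialComplex V) (q : ℕ) : Type _ :=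
  Quotient (OrderedSimplex.setoid K q)

/-- The oriented simplex `⟨a_0 ... a_q⟩` represented by an ordered simplex. -/
def OrderedSimplex.oriented {V : Type*} {K : AbstractSimplicialComplex V} {q : ℕ}
    (s : OrderedSimplex K q) : OrientedSimplex K q :=
  Quotient.mk _ s

/-- The simplex (set of vertices) underlying an oriented simplex. -/
def OrientedSimplex.support {V : Type*} {K : AbstractSimplicialComplex V} {q : ℕ}
    (τ : OrientedSimplex K q) : Finset V :=
  Quotient.lift OrderedSimplex.support
    (by rintro s _ ⟨π, -, rfl⟩; exact (s.support_perm π).symm) τ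

theorem OrientedSimplex.exists_rep {V : Type*} {K : AbstractSimplicialComplex V} {q : ℕ}
    (τ : OrientedSimplex K q) : ∃ s : OrderedSimplex K q, s.oriented = τ :=
  Quotient.exists_rep τ

theorem OrderedSimplex.support_oriented {V : Type*} {K : AbstractSimplicialComplex V} {q : ℕ}
    (s : OrderedSimplex K q) : s.oriented.support = s.support := rfl

theorem OrientedSimplex.support_mem {V : Type*} {K : AbstractSimplicialComplex V} {q : ℕ}
    (τ : OrientedSimplex K q) : τ.support ∈ K.faces := by
  obtain ⟨s, rfl⟩ := τ.exists_rep
  exact s.mem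

theorem OrientedSimplex.card_support {V : Type*} {K : AbstractSimplicialComplex V} {q : ℕ}
    (τ : OrientedSimplex K q) : τ.support.card = q + 1 := by
  obtain ⟨s, rfl⟩ := τ.exists_rep
  simp [OrderedSimplex.support_oriented, OrderedSimplex.support]

theorem exists_oriented {V : Type*} {K : AbstractSimplicialComplex V} {q : ℕ} {F : Finset V}
    (hF : F ∈ K.faces) (hc : F.card = q + 1) : ∃ μ : OrientedSimplex K q, μ.support = F := by
  let e : Fin (q + 1) ≃ F := (F.equivFinOfCardEq hc).symm
  have hinj : Function.Injective (fun i => (e i : V)) :=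
    Subtype.val_injective.comp e.injective
  have himg : Finset.univ.map ⟨fun i => (e i : V), hinj⟩ = F := by
    ext v
    simp only [Finset.mem_map, Finset.mem_univ, true_and, Function.Embedding.coeFn_mk]
    constructor
    · rintro ⟨i, rfl⟩
      exact (e i).2
    · intro hv
      exact ⟨e.symm ⟨v, hv⟩, by simp⟩
  let s : OrderedSimplex K q := ⟨fun i => (e i : V), hinj, by rw [himg]; exact hF⟩
  exact ⟨s.oriented, himg⟩

open Classical in
/-- The signature `sgn(σ, τ)`: it is `(-1)^j` if `σ = ⟨a_0 ... a_{q+1}⟩` and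
`τ = ⟨a_0 ... â_j ... a_{q+1}⟩`, and `0` if `τ` is not a face of `σ`. -/
def sgn {V : Type*} {K : AbstractSimplicialComplex V} {q : ℕ} (σ : OrientedSimplex K (q + 1))
    (τ : OrientedSimplex K q) : ℤ :=
  if ∃ (s : OrderedSimplex K (q + 1)) (j : Fin (q + 2)),
      s.oriented = σ ∧ (s.face j).oriented = τ ∧ Even (j : ℕ) then 1
  else if ∃ (s : OrderedSimplex K (q + 1)) (j : Fin (q + 2)),
      s.oriented = σ ∧ (s.face j).oriented = τ ∧ Odd (j : ℕ) then -1
  else 0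

theorem abs_sgn_le {V : Type*} {K : AbstractSimplicialComplex V} {q : ℕ}
    (σ : OrientedSimplex K (q + 1)) (τ : OrientedSimplex K q) : |sgn σ τ| ≤ 1 := by
  unfold sgn
  split_ifs <;> simp

/-- There are at most two orientations of a simplex of positive dimension. -/
theorem OrientedSimplex.eq_or_eq_or_eq {V : Type*} {K : AbstractSimplicialComplex V} {p : ℕ}
    (τ : OrientedSimplex K (p + 1)) :
    ∃ τ' : OrientedSimplex K (p + 1), ∀ ρ : OrientedSimplex K (p + 1),
      ρ.support = τ.support → ρ = τ ∨ ρ = τ' := by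
  obtain ⟨s, rfl⟩ := τ.exists_rep
  refine ⟨(s.perm (Equiv.swap 0 1)).oriented, fun ρ hρ => ?_⟩
  obtain ⟨t, rfl⟩ := ρ.exists_rep
  rw [OrderedSimplex.support_oriented, OrderedSimplex.support_oriented] at hρ
  have h : ∀ i, ∃ j, s.vertex j = t.vertex i := fun i => by
    rw [← OrderedSimplex.mem_support, ← hρ, OrderedSimplex.mem_support]
    exact ⟨i, rfl⟩
  choose f hf using h
  have hfi : Function.Injective f := fun i j hij => t.injective (by rw [← hf, ← hf, hij])
  let π : Equiv.Perm (Fin (p + 2)) :=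
    Equiv.ofBijective f (Finite.injective_iff_bijective.mp hfi)
  have ht : t = s.perm π := OrderedSimplex.ext_vertex (funext fun i => (hf i).symm)
  rcases Int.units_eq_one_or (Equiv.Perm.sign π) with h1 | h1
  · exact Or.inl (Quotient.sound (Setoid.symm ⟨π, h1, ht⟩))
  · refine Or.inr (Quotient.sound (Setoid.symm ⟨Equiv.swap 0 1 * π, ?_, ?_⟩))
    · rw [Equiv.Perm.sign_mul, h1, Equiv.Perm.sign_swap (by simp)]
      simp
    · rw [ht]
      refine OrderedSimplex.ext_vertex (funext fun i => ?_)
      simp [OrderedSimplex.perm]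

end Simplices

/-! ### The down graph `Y_q` (here `q = p + 1 ≥ 1`) -/

section DownGraph

/-- Two sets of vertices (to be used for `(p+1)`-dimensional simplices) are down neighbors if their
intersection is a `p`-dimensional simplex. -/
def DownNeighbor {V : Type*} [DecidableEq V] (K : AbstractSimplicialComplex V) (p : ℕ)
    (F G : Finset V) : Prop :=
  F ∩ G ∈ K.faces ∧ (F ∩ G).card = p + 1

theorem DownNeighbor.symm {V : Type*} [DecidableEq V] {K : AbstractSimplicialComplex V} {p : ℕ}
    {F G : Finset V} (h : DownNeighbor K p F G) : DownNeighbor K p G F := by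
  rwa [DownNeighbor, Finset.inter_comm]

/-- Down neighbors have different underlying simplices; in particular they are
different, and they are not opposite orientations of the same simplex. -/
theorem DownNeighbor.support_ne {V : Type*} [DecidableEq V] {K : AbstractSimplicialComplex V}
    {p : ℕ} {τ₁ τ₂ : OrientedSimplex K (p + 1)} (h : DownNeighbor K p τ₁.support τ₂.support) :
    τ₁.support ≠ τ₂.support := by
  intro he
  have h2 := h.2
  rw [he, Finset.inter_self, τ₂.card_support] at h2
  omega

/-- The oriented edges of the down graph `Y_{p+1}`, whose vertices are the oriented
`(p+1)`-simplices. -/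
def DownEdge {V : Type*} [DecidableEq V] (K : AbstractSimplicialComplex V) (p : ℕ) : Type _ :=
  {e : OrientedSimplex K (p + 1) × OrientedSimplex K (p + 1) //
    DownNeighbor K p e.1.support e.2.support}

/-- The edge with the opposite direction. -/
def DownEdge.rev {V : Type*} [DecidableEq V] {K : AbstractSimplicialComplex V} {p : ℕ}
    (e : DownEdge K p) : DownEdge K p :=
  ⟨(e.1.2, e.1.1), e.2.symm⟩

/-- The number of (unoriented) simplices that are down neighbors of `τ`. -/
def downDegree {V : Type*} [DecidableEq V] (K : AbstractSimplicialComplex V) (p : ℕ)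
    (τ : OrientedSimplex K (p + 1)) : ℕ :=
  {G : Finset V | G ∈ K.faces ∧ G.card = p + 2 ∧ DownNeighbor K p τ.support G}.ncard

/-- An orientation of the common `p`-dimensional face of two down neighbors. -/
def DownEdge.common {V : Type*} [DecidableEq V] {K : AbstractSimplicialComplex V} {p : ℕ}
    (e : DownEdge K p) : OrientedSimplex K p :=
  Classical.choose (exists_oriented e.2.1 e.2.2)

/-- `η(τ₁, τ₂) = sgn(τ₁, μ) sgn(τ₂, μ)`, where `μ` is the common face of `τ₁` and `τ₂` with either
orientation. -/
def eta {V : Type*} [DecidableEq V] {K : AbstractSimplicialComplex V} {p : ℕ}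
    (e : DownEdge K p) : ℤ :=
  sgn e.1.1 e.common * sgn e.1.2 e.common

theorem norm_eta_le {V : Type*} [DecidableEq V] {K : AbstractSimplicialComplex V} {p : ℕ}
    (e : DownEdge K p) : ‖((eta e : ℤ) : ℂ)‖ ≤ 1 := by
  have h : |eta e| ≤ 1 := by
    rw [eta, abs_mul]
    exact mul_le_one₀ (abs_sgn_le _ _) (abs_nonneg _) (abs_sgn_le _ _)
  rw [Complex.norm_intCast]
  exact_mod_cast h

/-- The oriented simplices adjacent to `τ` in the down graph. -/
def AdjTo {V : Type*} [DecidableEq V] (K : AbstractSimplicialComplex V) (p : ℕ)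
    (τ : OrientedSimplex K (p + 1)) : Type _ :=
  {τ' : OrientedSimplex K (p + 1) // DownNeighbor K p τ.support τ'.support}

/-- The directed edge from `τ` to a neighbor of `τ`. -/
def AdjTo.edge {V : Type*} [DecidableEq V] {K : AbstractSimplicialComplex V} {p : ℕ}
    {τ : OrientedSimplex K (p + 1)} (x : AdjTo K p τ) : DownEdge K p :=
  ⟨(τ, x.1), x.2⟩

theorem finite_and_card_adjTo {V : Type*} [DecidableEq V] (K : AbstractSimplicialComplex V)
    (p : ℕ) (τ : OrientedSimplex K (p + 1)) (h : downDegree K p τ ≠ 0) :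
    Finite (AdjTo K p τ) ∧ Nat.card (AdjTo K p τ) ≤ 2 * downDegree K p τ := by
  classical
  set N : Set (Finset V) :=
    {G : Finset V | G ∈ K.faces ∧ G.card = p + 2 ∧ DownNeighbor K p τ.support G} with hN
  have hNf : N.Finite := Set.finite_of_ncard_ne_zero h
  set A : Set (OrientedSimplex K (p + 1)) := {τ' | DownNeighbor K p τ.support τ'.support} with hA
  have hmaps : ∀ ρ ∈ A, ρ.support ∈ N := fun ρ hρ => ⟨ρ.support_mem, ρ.card_support, hρ⟩
  have hfib : ∀ G : Finset V, ∃ a b : OrientedSimplex K (p + 1), ∀ ρ ∈ A, ρ.support = G →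
      ρ = a ∨ ρ = b := by
    intro G
    by_cases hG : ∃ ρ : OrientedSimplex K (p + 1), ρ.support = G
    · obtain ⟨a, ha⟩ := hG
      obtain ⟨b, hb⟩ := a.eq_or_eq_or_eq
      exact ⟨a, b, fun ρ _ hρ => hb ρ (hρ.trans ha.symm)⟩
    · exact ⟨τ, τ, fun ρ _ hρ => (hG ⟨ρ, hρ⟩).elim⟩
  have hAf : A.Finite := by
    refine Set.Finite.of_finite_fibers OrientedSimplex.support
      (hNf.subset (by rintro _ ⟨ρ, hρ, rfl⟩; exact hmaps ρ hρ)) ?_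
    intro G _
    obtain ⟨a, b, hab⟩ := hfib G
    refine (Set.toFinite {a, b}).subset ?_
    rintro ρ ⟨hρ, hρG⟩
    simpa using hab ρ hρ hρG
  refine ⟨hAf, ?_⟩
  have hcard : Nat.card (AdjTo K p τ) = hAf.toFinset.card := by
    have h1 : Nat.card (AdjTo K p τ) = A.ncard := Nat.card_coe_set_eq A
    rw [h1, Set.ncard_eq_toFinset_card A hAf]
  have hdeg : downDegree K p τ = hNf.toFinset.card := Set.ncard_eq_toFinset_card N hNf
  rw [hcard, hdeg]
  refine Finset.card_le_mul_card_image_of_maps_to (f := OrientedSimplex.support) ?_ 2 ?_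
  · intro ρ hρ
    simpa using hmaps ρ (by simpa using hρ)
  · intro G _
    obtain ⟨a, b, hab⟩ := hfib G
    refine (Finset.card_le_card (t := {a, b}) ?_).trans Finset.card_le_two
    intro ρ hρ
    simp only [Finset.mem_filter, Set.Finite.mem_toFinset] at hρ
    simpa using hab ρ hρ.1 hρ.2

end DownGraph

/-! ### The down-Grover walk and its discriminant -/

section Operators

/-- The Hilbert space `ℓ²(X)` of square summable functions `X → ℂ`. -/
abbrev EllTwo (X : Type*) : Type _ := lp (fun _ : X => ℂ) 2

theorem EllTwo.summable {X : Type*} (g : EllTwo X) : Summable fun x => ‖g x‖ ^ 2 := by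
  have h := (lp.memℓp g).summable (by norm_num)
  simpa using h

theorem EllTwo.norm_sq {X : Type*} (g : EllTwo X) : ‖g‖ ^ 2 = ∑' x, ‖g x‖ ^ 2 := by
  have h := lp.norm_rpow_eq_tsum (p := 2) (by norm_num) g
  simpa using h

/-- A linear map given by a pointwise formula which does not increase the `ℓ²`-norm, as
a bounded operator between `ℓ²`-spaces. -/
def mkContraction {X Y : Type*} (T : EllTwo X → Y → ℂ)
    (hadd : ∀ f g, T (f + g) = T f + T g) (hsmul : ∀ (c : ℂ) f, T (c • f) = c • T f)
    (hle : ∀ f (s : Finset Y), ∑ y ∈ s, ‖T f y‖ ^ 2 ≤ ‖f‖ ^ 2) : EllTwo X →L[ℂ] EllTwo Y :=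
  LinearMap.mkContinuous
    { toFun := fun f => ⟨T f, memℓp_gen' (C := ‖f‖ ^ 2) (by simpa using hle f)⟩
      map_add' := fun f g => lp.ext (hadd f g)
      map_smul' := fun c f => lp.ext (hsmul c f) } 1 (by
    intro f
    rw [one_mul]
    refine (sq_le_sq₀ (norm_nonneg _) (norm_nonneg f)).mp ?_
    rw [EllTwo.norm_sq]
    exact Real.tsum_le_of_sum_le (fun _ => by positivity) (hle f))

/-- The operator `d : ℓ²(E(Y_{p+1})) → ℓ²(K_{p+1})`,
`(d g)(τ) = (2 deg τ)^{-1/2} ∑_{τ'} g(τ, τ')`, the sum being over the neighbors of `τ`. -/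
def boundaryFun {V : Type*} [DecidableEq V] (K : AbstractSimplicialComplex V) (p : ℕ)
    (g : EllTwo (DownEdge K p)) (τ : OrientedSimplex K (p + 1)) : ℂ :=
  ((1 / Real.sqrt (2 * downDegree K p τ) : ℝ) : ℂ) *
    ∑' τ' : AdjTo K p τ, g τ'.edge

theorem norm_boundaryFun_sq_le {V : Type*} [DecidableEq V] (K : AbstractSimplicialComplex V)
    (p : ℕ) (g : EllTwo (DownEdge K p)) (τ : OrientedSimplex K (p + 1)) :
    ‖boundaryFun K p g τ‖ ^ 2 ≤ ∑' τ' : AdjTo K p τ, ‖g τ'.edge‖ ^ 2 := by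
  by_cases h : downDegree K p τ = 0
  · rw [boundaryFun, h]
    simpa using tsum_nonneg fun _ => by positivity
  · obtain ⟨hfin, hcard⟩ := finite_and_card_adjTo K p τ h
    have : Fintype (AdjTo K p τ) := Fintype.ofFinite _
    rw [boundaryFun, tsum_fintype, tsum_fintype, norm_mul, mul_pow, Complex.norm_real,
      Real.norm_eq_abs, sq_abs, div_pow, one_pow, Real.sq_sqrt (by positivity)]
    have hd : (0 : ℝ) < 2 * downDegree K p τ := by positivity
    rw [Nat.card_eq_fintype_card] at hcard
    have hc : (Fintype.card (AdjTo K p τ) : ℝ) ≤ 2 * downDegree K p τ := by exact_mod_cast hcard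
    rw [one_div, inv_mul_le_iff₀ hd]
    calc ‖∑ τ' : AdjTo K p τ, g τ'.edge‖ ^ 2
        ≤ (∑ τ' : AdjTo K p τ, ‖g τ'.edge‖) ^ 2 := by
          gcongr
          exact norm_sum_le _ _
      _ ≤ Fintype.card (AdjTo K p τ) * ∑ τ' : AdjTo K p τ, ‖g τ'.edge‖ ^ 2 :=
          sq_sum_le_card_mul_sum_sq
      _ ≤ _ := by gcongr

theorem sum_norm_boundaryFun_sq_le {V : Type*} [DecidableEq V] (K : AbstractSimplicialComplex V)
    (p : ℕ) (g : EllTwo (DownEdge K p)) (s : Finset (OrientedSimplex K (p + 1))) :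
    ∑ τ ∈ s, ‖boundaryFun K p g τ‖ ^ 2 ≤ ‖g‖ ^ 2 := by
  let e : (Σ τ : OrientedSimplex K (p + 1), AdjTo K p τ) ≃ DownEdge K p :=
    { toFun := fun x => ⟨(x.1, x.2.1), x.2.2⟩
      invFun := fun y => ⟨y.1.1, ⟨y.1.2, y.2⟩⟩
      left_inv := fun _ => rfl
      right_inv := fun _ => rfl }
  have hs : Summable fun x => ‖g (e x)‖ ^ 2 := e.summable_iff.mpr (EllTwo.summable g)
  have ht : ‖g‖ ^ 2 = ∑' τ, ∑' τ' : AdjTo K p τ, ‖g τ'.edge‖ ^ 2 := by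
    rw [EllTwo.norm_sq, ← e.tsum_eq, hs.tsum_sigma]
    rfl
  rw [ht]
  refine (Finset.sum_le_sum fun τ _ => norm_boundaryFun_sq_le K p g τ).trans ?_
  exact hs.sigma.sum_le_tsum s fun _ _ => tsum_nonneg fun _ => by positivity

/-- The operator `d : ℓ²(E(Y_{p+1})) → ℓ²(K_{p+1})` as a bounded operator. -/
def boundaryOp {V : Type*} [DecidableEq V] (K : AbstractSimplicialComplex V) (p : ℕ) :
    EllTwo (DownEdge K p) →L[ℂ] EllTwo (OrientedSimplex K (p + 1)) :=
  mkContraction (boundaryFun K p)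
    (by
      intro f g
      funext τ
      by_cases h : downDegree K p τ = 0
      · simp [boundaryFun, h]
      · have := (finite_and_card_adjTo K p τ h).1
        have : Fintype (AdjTo K p τ) := Fintype.ofFinite _
        have hfg : ∀ e, (f + g) e = f e + g e := fun _ => rfl
        simp only [boundaryFun, tsum_fintype, Pi.add_apply, hfg,
          Finset.sum_add_distrib, mul_add])
    (by
      intro c f
      funext τ
      have hcf : ∀ e, (c • f) e = c * f e := fun _ => rfl
      simp only [boundaryFun, hcf, Pi.smul_apply, smul_eq_mul, tsum_mul_left]
      ring)
    (sum_norm_boundaryFun_sq_le K p)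

/-- The shift operator `S` on `ℓ²(E(Y_{p+1}))`, `(S g)(τ₁, τ₂) = η(τ₁, τ₂) g(τ₂, τ₁)`. -/
def shiftOp {V : Type*} [DecidableEq V] (K : AbstractSimplicialComplex V) (p : ℕ) :
    EllTwo (DownEdge K p) →L[ℂ] EllTwo (DownEdge K p) :=
  mkContraction (fun g e => ((eta e : ℤ) : ℂ) * g e.rev)
    (by intro f g; funext e; simp [mul_add])
    (by intro c f; funext e; simp; ring)
    (by
      intro g s
      let r : DownEdge K p ≃ DownEdge K p :=
        { toFun := DownEdge.rev
          invFun := DownEdge.rev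
          left_inv := fun _ => rfl
          right_inv := fun _ => rfl }
      have hs : Summable fun e => ‖g (r e)‖ ^ 2 := r.summable_iff.mpr (EllTwo.summable g)
      rw [EllTwo.norm_sq, ← r.tsum_eq]
      refine (Finset.sum_le_sum fun e _ => ?_).trans
        (hs.sum_le_tsum s fun _ _ => by positivity)
      rw [norm_mul, mul_pow]
      exact mul_le_of_le_one_left (by positivity)
        (pow_le_one₀ (norm_nonneg _) (norm_eta_le e)))

/-- The down-Grover walk `U_{p+1}^down = S (2 d* d - I)` on `ℓ²(E(Y_{p+1}))`. -/
def downGroverWalk {V : Type*} [DecidableEq V] (K : AbstractSimplicialComplex V) (p : ℕ) :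
    EllTwo (DownEdge K p) →L[ℂ] EllTwo (DownEdge K p) :=
  shiftOp K p * ((2 : ℂ) • ((boundaryOp K p).adjoint ∘L boundaryOp K p) - 1)

/-- The down-discriminant `D_{p+1}^down = d S d*` on `ℓ²(K_{p+1})`. -/
def downDiscriminant {V : Type*} [DecidableEq V] (K : AbstractSimplicialComplex V) (p : ℕ) :
    EllTwo (OrientedSimplex K (p + 1)) →L[ℂ] EllTwo (OrientedSimplex K (p + 1)) :=
  boundaryOp K p ∘L shiftOp K p ∘L (boundaryOp K p).adjoint

end Operators

/-! ### Parts of the spectrum -/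

section Spectrum

/-- The point spectrum: the set of eigenvalues. -/
def pointSpectrum {H : Type*} [NormedAddCommGroup H] [NormedSpace ℂ H] (T : H →L[ℂ] H) : Set ℂ :=
  {z | Module.End.HasEigenvalue (T : H →ₗ[ℂ] H) z}

/-- The continuous spectrum: the spectral values `z`, not eigenvalues, for which
`T - z` has dense range. -/
def continuousSpectrum {H : Type*} [NormedAddCommGroup H] [NormedSpace ℂ H] (T : H →L[ℂ] H) :
    Set ℂ :=
  {z | z ∈ spectrum ℂ T ∧ z ∉ pointSpectrum T ∧ DenseRange fun x => T x - z • x}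

end Spectrum

/-! ### The triangulated infinite cylinder -/

section Cylinder

/-- The triangle with vertices `(l, n)`, `(l, n + 1)`, `(l + 1, n + 1)`. -/
def rhoTriangle (l : ZMod 3) (n : ℤ) : Finset (ZMod 3 × ℤ) :=
  {(l, n), (l, n + 1), (l + 1, n + 1)}

/-- The triangle with vertices `(l, n)`, `(l + 1, n + 1)`, `(l + 1, n)`. -/
def sigmaTriangle (l : ZMod 3) (n : ℤ) : Finset (ZMod 3 × ℤ) :=
  {(l, n), (l + 1, n + 1), (l + 1, n)}

/-- The triangulation of the infinite cylinder with vertex set `ℤ/3 × ℤ` in which each square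
`(l, n)`, `(l + 1, n)`, `(l + 1, n + 1)`, `(l, n + 1)` is cut along the diagonal from `(l, n)` to
`(l + 1, n + 1)`: the simplices are the nonempty subsets of these triangles. -/
def cylinder : AbstractSimplicialComplex (ZMod 3 × ℤ) where
  faces := {F | F.Nonempty ∧ ∃ (l : ZMod 3) (n : ℤ), F ⊆ rhoTriangle l n ∨ F ⊆ sigmaTriangle l n}
  isRelLowerSet_faces := by
    rintro F ⟨hF, l, n, h⟩
    exact ⟨hF, fun G hG hne => ⟨hne, l, n, h.imp hG.trans hG.trans⟩⟩
  singleton_mem := by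
    rintro ⟨l, n⟩
    exact ⟨Finset.singleton_nonempty _, l, n, Or.inl (by simp [rhoTriangle])⟩

end Cylinder

end DownWalk

end

open DownWalk

/-!
Off `±1` the spectrum of the walk `S (2 d* d - 1)` is governed by the discriminant `D = d S d*`: a
unimodular `z` lies in the spectrum of the walk, or is an eigenvalue, exactly when `Re z` does so
for `D`. This leaves the two discriminants. They vanish on the functions invariant under reversal
of the orientation, and so live on the antisymmetric functions of oriented simplices.

Both come from one operator on `ℓ²(ℤ/3 × ℤ)`. Let `N = T T*`, where `T` is the sum of the identity
and of the two shifts by which adjacent triangles overlap; `N` is a Laurent polynomial in the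
translations, has no eigenvalue, and its spectrum is `[0, 9]`. On the two kinds of triangles, `D` is
`-1/3` times the off-diagonal matrix with entries `T` and `T*`, so that its square is `N / 9`. On
edges, `D` is a multiple of `∂* ∂` minus `1/5` of the antisymmetric projection, and the nonzero
spectrum of `∂* ∂` is that of the vertex Laplacian `∂ ∂* = 9 - N`, up to normalisation.
-/

noncomputable section

namespace DownWalk

open scoped InnerProductSpace
open Equiv.Perm (sign)

/-! ### Spectra of normal operators -/

section Spectra

variable {E F : Type*} [NormedAddCommGroup E] [InnerProductSpace ℂ E]
  [NormedAddCommGroup F] [InnerProductSpace ℂ F]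

theorem mem_pointSpectrum {T : E →L[ℂ] E} {z : ℂ} :
    z ∈ pointSpectrum T ↔ ∃ f, f ≠ 0 ∧ T f = z • f := by
  constructor
  · intro h
    obtain ⟨f, hf⟩ := Module.End.HasEigenvalue.exists_hasEigenvector h
    exact ⟨f, hf.2, hf.apply_eq_smul⟩
  · rintro ⟨f, hf, h⟩
    exact Module.End.hasEigenvalue_of_hasEigenvector ⟨Module.End.mem_eigenspace_iff.mpr h, hf⟩

theorem notMem_pointSpectrum {T : E →L[ℂ] E} {z : ℂ} :
    z ∉ pointSpectrum T ↔ ∀ f, T f = z • f → f = 0 := by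
  simp only [mem_pointSpectrum, not_exists, not_and', not_not, ne_eq]

theorem isUnit_sub_smul_one_iff {T : E →L[ℂ] E} {z : ℂ} :
    IsUnit (T - z • (1 : E →L[ℂ] E)) ↔ z ∉ spectrum ℂ T := by
  rw [spectrum.notMem_iff, ← IsUnit.neg_iff, neg_sub, Algebra.algebraMap_eq_smul_one]

theorem pointSpectrum_subset_spectrum (T : E →L[ℂ] E) :
    pointSpectrum T ⊆ spectrum ℂ T := by
  intro z hz
  contrapose! hz
  have hu := (isUnit_sub_smul_one_iff.mpr hz).map ContinuousLinearMap.toLinearMapRingHom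
  refine notMem_pointSpectrum.mpr fun f hf => ((Module.End.isUnit_iff _).mp hu).injective ?_
  simp [hf]

theorem topologicalClosure_range_sub_smul_one [CompleteSpace E] {T : E →L[ℂ] E}
    (hT : IsStarNormal T) {z : ℂ} (hz : z ∉ pointSpectrum T) :
    (T - z • (1 : E →L[ℂ] E)).range.topologicalClosure = ⊤ := by
  have hN : IsStarNormal (T - z • (1 : E →L[ℂ] E)) :=
    Commute.isStarNormal_sub (by simpa using (Commute.one_right T).smul_right _)
  rw [Submodule.topologicalClosure_eq_top_iff,
    ContinuousLinearMap.IsStarNormal.orthogonal_range hN, Submodule.eq_bot_iff]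
  exact fun f hf => notMem_pointSpectrum.mp hz f (by simpa [sub_eq_zero] using hf)

theorem continuousSpectrum_eq [CompleteSpace E] {T : E →L[ℂ] E} (hT : IsStarNormal T) :
    continuousSpectrum T = spectrum ℂ T \ pointSpectrum T := by
  ext z
  refine and_congr_right fun _ => and_iff_left_of_imp fun hz => ?_
  exact Submodule.dense_iff_topologicalClosure_eq_top.mpr
    (topologicalClosure_range_sub_smul_one hT hz)

theorem not_isClosed_range_sub_smul_one [CompleteSpace E] {T : E →L[ℂ] E} {z : ℂ}
    (hz : z ∈ continuousSpectrum T) :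
    ¬IsClosed (Set.range (T - z • (1 : E →L[ℂ] E))) := by
  obtain ⟨hspec, hpoint, hdense⟩ := hz
  refine fun hclosed => isUnit_sub_smul_one_iff.not_left.mpr hspec ?_
  refine ContinuousLinearMap.isUnit_iff_bijective.mpr ⟨?_, ?_⟩
  · refine (injective_iff_map_eq_zero _).mpr fun f hf => notMem_pointSpectrum.mp hpoint f ?_
    simpa [sub_eq_zero] using hf
  · rw [← Set.range_eq_univ, ← hclosed.closure_eq]
    exact hdense.closure_eq

theorem mul_add_mem_spectrum_iff {T : E →L[ℂ] E} {a b z : ℂ} (hb : b ≠ 0) :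
    b * z + a ∈ spectrum ℂ (b • T + a • (1 : E →L[ℂ] E)) ↔ z ∈ spectrum ℂ T := by
  have hsub : b • T + a • (1 : E →L[ℂ] E) - (b * z + a) • (1 : E →L[ℂ] E) =
      Units.mk0 b hb • (T - z • (1 : E →L[ℂ] E)) := by
    rw [Units.smul_mk0]
    module
  rw [← not_iff_not, ← isUnit_sub_smul_one_iff, ← isUnit_sub_smul_one_iff, hsub, isUnit_smul_iff]

theorem mul_add_mem_pointSpectrum_iff {T : E →L[ℂ] E} {a b z : ℂ} (hb : b ≠ 0) :
    b * z + a ∈ pointSpectrum (b • T + a • (1 : E →L[ℂ] E)) ↔ z ∈ pointSpectrum T := by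
  have heigen (f : E) :
      (b • T + a • (1 : E →L[ℂ] E)) f = (b * z + a) • f ↔ T f = z • f := by
    rw [_root_.add_apply, _root_.smul_apply, _root_.smul_apply, one_apply_eq_self, add_smul,
      add_left_inj, mul_smul, (smul_right_injective E hb).eq_iff]
  simp only [mem_pointSpectrum, heigen]

theorem isStarNormal_smul_add_smul_one [CompleteSpace E] {T : E →L[ℂ] E} (hT : IsStarNormal T)
    (a b : ℂ) : IsStarNormal (b • T + a • (1 : E →L[ℂ] E)) := by
  refine ⟨?_⟩
  simp only [star_add, star_smul, star_one]
  exact (((hT.star_comm_self.smul_left _).smul_right _).add_left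
    ((Commute.one_left _).smul_left _)).add_right ((Commute.one_right _).smul_right _)

/-- A bounded operator is bounded below if it is injective with bounded inverse on its range. -/
def IsBoundedBelow (T : E →L[ℂ] F) : Prop :=
  ∃ c : ℝ, ∀ f, ‖f‖ ≤ c * ‖T f‖

theorem notMem_spectrum_iff_isBoundedBelow [CompleteSpace E] {T : E →L[ℂ] E}
    (hT : IsStarNormal T) {z : ℂ} :
    z ∉ spectrum ℂ T ↔ IsBoundedBelow (T - z • (1 : E →L[ℂ] E)) := by
  rw [← isUnit_sub_smul_one_iff, ContinuousLinearMap.isUnit_iff_bijective,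
    ContinuousLinearMap.bijective_iff_dense_range_and_antilipschitz]
  constructor
  · rintro ⟨-, K, hK⟩
    exact ⟨K, fun f => by simpa using hK.le_mul_dist f 0⟩
  · rintro ⟨c, hc⟩
    refine ⟨topologicalClosure_range_sub_smul_one hT (notMem_pointSpectrum.mpr fun f hf => ?_),
      c.toNNReal, AddMonoidHomClass.antilipschitz_of_bound _ fun f => (hc f).trans ?_⟩
    · simpa [hf] using hc f
    · gcongr
      exact Real.le_coe_toNNReal c

end Spectra

section Domination

variable {E F : Type*} [NormedAddCommGroup E] [InnerProductSpace ℂ E]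
  [NormedAddCommGroup F] [InnerProductSpace ℂ F]

/-- `Dominates A T`: some bounded operator `d` carries `T` into `A` (in the sense that `A d` factors
through `T`) and has, modulo `T`, a left inverse up to a nonzero factor. Then `T` inherits
injectivity and boundedness from below from `A`. -/
def Dominates (A : F →L[ℂ] F) (T : E →L[ℂ] E) : Prop :=
  ∃ (d B : E →L[ℂ] F) (P : F →L[ℂ] E) (Q : E →L[ℂ] E) (c : ℂ), c ≠ 0 ∧
    (∀ f, A (d f) = B (T f)) ∧ ∀ f, P (d f) + Q (T f) = c • f

theorem Dominates.isBoundedBelow {A : F →L[ℂ] F} {T : E →L[ℂ] E} (h : Dominates A T)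
    (hA : IsBoundedBelow A) : IsBoundedBelow T := by
  obtain ⟨d, B, P, Q, c, hc, hAB, hPQ⟩ := h
  obtain ⟨a, ha⟩ := hA
  have hd (f : E) : ‖d f‖ ≤ |a| * (‖B‖ * ‖T f‖) := calc
    ‖d f‖ ≤ a * ‖B (T f)‖ := hAB f ▸ ha (d f)
    _ ≤ |a| * (‖B‖ * ‖T f‖) := by
      gcongr
      exacts [le_abs_self a, B.le_opNorm _]
  refine ⟨(‖P‖ * (|a| * ‖B‖) + ‖Q‖) / ‖c‖, fun f => ?_⟩
  rw [div_mul_eq_mul_div, le_div_iff₀ (norm_pos_iff.mpr hc), mul_comm, ← norm_smul, ← hPQ f]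
  calc ‖P (d f) + Q (T f)‖ ≤ ‖P‖ * ‖d f‖ + ‖Q‖ * ‖T f‖ :=
        norm_add_le_of_le (P.le_opNorm _) (Q.le_opNorm _)
    _ ≤ ‖P‖ * (|a| * (‖B‖ * ‖T f‖)) + ‖Q‖ * ‖T f‖ := by
        gcongr
        exact hd f
    _ = (‖P‖ * (|a| * ‖B‖) + ‖Q‖) * ‖T f‖ := by ring

theorem Dominates.eq_zero {A : F →L[ℂ] F} {T : E →L[ℂ] E} (h : Dominates A T)
    (hA : ∀ g, A g = 0 → g = 0) {f : E} (hf : T f = 0) : f = 0 := by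
  obtain ⟨d, B, P, Q, c, hc, hAB, hPQ⟩ := h
  have hd : d f = 0 := hA _ (by rw [hAB, hf, map_zero])
  simpa [hd, hf, hc, eq_comm] using hPQ f

theorem Dominates.mem_pointSpectrum {A : F →L[ℂ] F} {T : E →L[ℂ] E} {a b : ℂ}
    (h : Dominates (A - a • (1 : F →L[ℂ] F)) (T - b • (1 : E →L[ℂ] E)))
    (hb : b ∈ pointSpectrum T) : a ∈ pointSpectrum A := by
  contrapose! hb
  rw [notMem_pointSpectrum] at hb ⊢
  exact fun f hf => h.eq_zero (fun g hg => hb g (by simpa [sub_eq_zero] using hg)) (by simp [hf])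

theorem Dominates.mem_spectrum [CompleteSpace E] [CompleteSpace F] {A : F →L[ℂ] F}
    {T : E →L[ℂ] E} {a b : ℂ} (hA : IsStarNormal A) (hT : IsStarNormal T)
    (h : Dominates (A - a • (1 : F →L[ℂ] F)) (T - b • (1 : E →L[ℂ] E)))
    (hb : b ∈ spectrum ℂ T) : a ∈ spectrum ℂ A := by
  contrapose! hb
  rw [notMem_spectrum_iff_isBoundedBelow hA] at hb
  rw [notMem_spectrum_iff_isBoundedBelow hT]
  exact h.isBoundedBelow hb

theorem isClosed_range_of_intertwining {A : F →L[ℂ] F} {T : E →L[ℂ] E} {d B : E →L[ℂ] F}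
    {d' B' : F →L[ℂ] E} {C : E →L[ℂ] E} {c : ℂ} (hA : IsClosed (Set.range A)) (hc : c ≠ 0)
    (hAd : ∀ f, A (d f) = B (T f)) (hTd : ∀ g, T (d' g) = B' (A g))
    (hB : ∀ f, B' (B f) = c • f + T (C f)) : IsClosed (Set.range T) := by
  refine isClosed_of_closure_subset fun f hf => ?_
  have hBf : B f ∈ closure (Set.range A) :=
    map_mem_closure B.continuous hf (by rintro _ ⟨x, rfl⟩; exact ⟨d x, hAd x⟩)
  rw [hA.closure_eq] at hBf
  obtain ⟨g, hg⟩ := hBf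
  refine ⟨c⁻¹ • (d' g - C f), ?_⟩
  rw [map_smul, map_sub, hTd, hg, hB, add_sub_cancel_right, inv_smul_smul₀ hc]

end Domination

/-! ### Walks and their discriminants -/

section Walk

variable {H E : Type*} [NormedAddCommGroup H] [InnerProductSpace ℂ H] [CompleteSpace H]
  [NormedAddCommGroup E] [InnerProductSpace ℂ E] [CompleteSpace E]

theorem mul_conj_of_norm_eq_one {z : ℂ} (hz : ‖z‖ = 1) : z * starRingEnd ℂ z = 1 := by
  rw [Complex.mul_conj', hz, Complex.ofReal_one, one_pow]

/-- A coisometry `d` and a self-adjoint involution `S`: the data from which an abstract quantum walk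
and its discriminant are built. -/
structure IsWalkPair (d : E →L[ℂ] H) (S : E →L[ℂ] E) : Prop where
  coisometry : ∀ f, d (d.adjoint f) = f
  involutive : ∀ g, S (S g) = g
  selfAdjoint : S.adjoint = S

/-- The quantum walk `S (2 d* d - 1)` of a pair `(d, S)`; the down-Grover walk is the case of
`boundaryOp` and `shiftOp`. -/
def walkOp (d : E →L[ℂ] H) (S : E →L[ℂ] E) : E →L[ℂ] E :=
  S * ((2 : ℂ) • (d.adjoint ∘L d) - 1)

/-- The discriminant `d S d*` of a pair `(d, S)`; the down-discriminant is the case of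
`boundaryOp` and `shiftOp`. -/
def discriminantOp (d : E →L[ℂ] H) (S : E →L[ℂ] E) : H →L[ℂ] H :=
  d ∘L S ∘L d.adjoint

/-- The map `f ↦ z S d* f - d* f`, which sends eigenvectors of the discriminant for `Re z` to
eigenvectors of the walk for `z` when `|z| = 1`. -/
def walkLift (d : E →L[ℂ] H) (S : E →L[ℂ] E) (z : ℂ) : H →L[ℂ] E :=
  z • (S ∘L d.adjoint) - d.adjoint

namespace IsWalkPair

variable {d : E →L[ℂ] H} {S : E →L[ℂ] E} {z : ℂ}

theorem isSelfAdjoint_discriminantOp (h : IsWalkPair d S) : IsSelfAdjoint (discriminantOp d S) := by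
  rw [ContinuousLinearMap.isSelfAdjoint_iff', discriminantOp, ContinuousLinearMap.adjoint_comp,
    ContinuousLinearMap.adjoint_comp, h.selfAdjoint, ContinuousLinearMap.adjoint_adjoint]
  rfl

theorem walkOp_mem_unitary (h : IsWalkPair d S) : walkOp d S ∈ unitary (E →L[ℂ] E) := by
  have hR : star ((2 : ℂ) • (d.adjoint ∘L d) - 1) = (2 : ℂ) • (d.adjoint ∘L d) - 1 := by
    simp [ContinuousLinearMap.star_eq_adjoint, ContinuousLinearMap.adjoint_comp]
  have hRR : ((2 : ℂ) • (d.adjoint ∘L d) - 1) * ((2 : ℂ) • (d.adjoint ∘L d) - 1) = 1 := by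
    ext g
    simp only [mul_apply_eq_comp, _root_.sub_apply, _root_.smul_apply,
      ContinuousLinearMap.coe_comp, Function.comp_apply, one_apply_eq_self, map_sub, map_smul,
      h.coisometry]
    module
  have hS : star S = S := h.selfAdjoint
  have hSS : S * S = 1 := by ext g; simp [h.involutive]
  rw [Unitary.mem_iff, walkOp, star_mul, hR, hS]
  constructor
  · rw [mul_assoc, ← mul_assoc S, hSS, one_mul, hRR]
  · rw [mul_assoc, ← mul_assoc _ _ S, hRR, one_mul, hSS]

theorem isStarNormal_walkOp (h : IsWalkPair d S) : IsStarNormal (walkOp d S) :=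
  isStarNormal_of_mem_unitary h.walkOp_mem_unitary

theorem walkOp_sub_smul_walkLift (h : IsWalkPair d S) (hz : ‖z‖ = 1) (f : H) :
    (walkOp d S - z • (1 : E →L[ℂ] E)) (walkLift d S z f)
      = ((2 * z) • (S ∘L d.adjoint)) ((discriminantOp d S - (z.re : ℂ) • (1 : H →L[ℂ] H)) f) := by
  have hzz := mul_conj_of_norm_eq_one hz
  simp only [walkOp, walkLift, discriminantOp, Complex.re_eq_add_conj, mul_apply_eq_comp,
    _root_.sub_apply, _root_.smul_apply, ContinuousLinearMap.coe_comp, Function.comp_apply,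
    one_apply_eq_self, map_sub, map_smul, h.coisometry, h.involutive]
  linear_combination (norm := module) hzz • S (d.adjoint f)

theorem discriminantOp_sub_smul_apply (h : IsWalkPair d S) (hz : ‖z‖ = 1) (g : E) :
    (discriminantOp d S - (z.re : ℂ) • (1 : H →L[ℂ] H)) (d g)
      = ((1 / 2 : ℂ) • (d - starRingEnd ℂ z • (d ∘L S)))
        ((walkOp d S - z • (1 : E →L[ℂ] E)) g) := by
  have hzz := mul_conj_of_norm_eq_one hz
  simp only [walkOp, discriminantOp, Complex.re_eq_add_conj, mul_apply_eq_comp,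
    _root_.sub_apply, _root_.smul_apply, ContinuousLinearMap.coe_comp, Function.comp_apply,
    one_apply_eq_self, map_sub, map_smul, h.coisometry, h.involutive]
  linear_combination (norm := module) (-(1 / 2 : ℂ)) • hzz • d (S g)

theorem apply_walkLift (h : IsWalkPair d S) (f : H) :
    d (walkLift d S z f) = z • discriminantOp d S f - f := by
  simp [walkLift, discriminantOp, h.coisometry]

theorem walkLift_apply (h : IsWalkPair d S) (g : E) :
    walkLift d S z (d g) = ((z ^ 2 - 1) / 2) • g +
      ((1 / 2 : ℂ) • (z • (1 : E →L[ℂ] E) - S)) ((walkOp d S - z • (1 : E →L[ℂ] E)) g) := by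
  simp only [walkOp, walkLift, mul_apply_eq_comp,
    _root_.sub_apply, _root_.smul_apply, ContinuousLinearMap.coe_comp, Function.comp_apply,
    one_apply_eq_self, map_sub, map_smul, h.involutive]
  module

theorem dominates_walkOp (h : IsWalkPair d S) (hz : ‖z‖ = 1) (hz2 : z ^ 2 ≠ 1) :
    Dominates (discriminantOp d S - (z.re : ℂ) • (1 : H →L[ℂ] H))
      (walkOp d S - z • (1 : E →L[ℂ] E)) :=
  ⟨d, _, walkLift d S z, -((1 / 2 : ℂ) • (z • (1 : E →L[ℂ] E) - S)), (z ^ 2 - 1) / 2,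
    div_ne_zero (sub_ne_zero.mpr hz2) two_ne_zero, h.discriminantOp_sub_smul_apply hz,
    fun g => by rw [h.walkLift_apply, _root_.neg_apply, add_neg_cancel_right]⟩

theorem dominates_discriminantOp (h : IsWalkPair d S) (hz : ‖z‖ = 1) (hz2 : z ^ 2 ≠ 1) :
    Dominates (walkOp d S - z • (1 : E →L[ℂ] E))
      (discriminantOp d S - (z.re : ℂ) • (1 : H →L[ℂ] H)) := by
  have hzz := mul_conj_of_norm_eq_one hz
  refine ⟨walkLift d S z, _, d, -z • 1, (z ^ 2 - 1) / 2,
    div_ne_zero (sub_ne_zero.mpr hz2) two_ne_zero, h.walkOp_sub_smul_walkLift hz, fun f => ?_⟩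
  simp only [h.apply_walkLift, Complex.re_eq_add_conj, _root_.sub_apply, _root_.smul_apply,
    one_apply_eq_self]
  linear_combination (norm := module) (1 / 2 : ℂ) • hzz • f

theorem mem_spectrum_walkOp_iff (h : IsWalkPair d S) (hz : ‖z‖ = 1) (hz2 : z ^ 2 ≠ 1) :
    z ∈ spectrum ℂ (walkOp d S) ↔ (z.re : ℂ) ∈ spectrum ℂ (discriminantOp d S) :=
  ⟨(h.dominates_walkOp hz hz2).mem_spectrum h.isSelfAdjoint_discriminantOp.isStarNormal
      h.isStarNormal_walkOp,
    (h.dominates_discriminantOp hz hz2).mem_spectrum h.isStarNormal_walkOp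
      h.isSelfAdjoint_discriminantOp.isStarNormal⟩

theorem mem_pointSpectrum_walkOp_iff (h : IsWalkPair d S) (hz : ‖z‖ = 1) (hz2 : z ^ 2 ≠ 1) :
    z ∈ pointSpectrum (walkOp d S) ↔ (z.re : ℂ) ∈ pointSpectrum (discriminantOp d S) :=
  ⟨(h.dominates_walkOp hz hz2).mem_pointSpectrum,
    (h.dominates_discriminantOp hz hz2).mem_pointSpectrum⟩

theorem mem_continuousSpectrum_walkOp_iff (h : IsWalkPair d S) (hz : ‖z‖ = 1) (hz2 : z ^ 2 ≠ 1) :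
    z ∈ continuousSpectrum (walkOp d S) ↔
      (z.re : ℂ) ∈ continuousSpectrum (discriminantOp d S) := by
  rw [continuousSpectrum_eq h.isStarNormal_walkOp,
    continuousSpectrum_eq h.isSelfAdjoint_discriminantOp.isStarNormal, Set.mem_sdiff, Set.mem_sdiff,
    h.mem_spectrum_walkOp_iff hz hz2, h.mem_pointSpectrum_walkOp_iff hz hz2]

theorem isClosed_range_discriminantOp (h : IsWalkPair d S) (hz : ‖z‖ = 1) (hz2 : z ^ 2 ≠ 1)
    (hU : IsClosed (Set.range (walkOp d S - z • (1 : E →L[ℂ] E)))) :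
    IsClosed (Set.range (discriminantOp d S - (z.re : ℂ) • (1 : H →L[ℂ] H))) := by
  have hzz := mul_conj_of_norm_eq_one hz
  refine isClosed_range_of_intertwining (C := z • 1) (c := (z ^ 2 - 1) / 2) hU
    (div_ne_zero (sub_ne_zero.mpr hz2) two_ne_zero) (h.walkOp_sub_smul_walkLift hz)
    (h.discriminantOp_sub_smul_apply hz) fun f => ?_
  simp only [discriminantOp, Complex.re_eq_add_conj, _root_.sub_apply, _root_.smul_apply,
    ContinuousLinearMap.coe_comp, Function.comp_apply, one_apply_eq_self, map_smul, h.coisometry,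
    h.involutive]
  linear_combination (norm := module) (-(1 / 2) : ℂ) • hzz • f

end IsWalkPair

end Walk

/-! ### Perturbing a factored operator by an idempotent -/

section Idempotent

variable {H K : Type*} [NormedAddCommGroup H] [InnerProductSpace ℂ H]
  [NormedAddCommGroup K] [InnerProductSpace ℂ K]
  {P : H →L[ℂ] H} {R : H →L[ℂ] K} {R' : K →L[ℂ] H} {a x : ℂ}

theorem dominates_idempotent_perturbation (hP : ∀ f, P (P f) = P f) (hR : ∀ f, R (P f) = R f)
    (hx : x ≠ 0) (hxa : x ≠ -a) :
    Dominates (R ∘L R' - a • (1 : K →L[ℂ] K) - x • (1 : K →L[ℂ] K))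
      (R' ∘L R - a • P - x • (1 : H →L[ℂ] H)) := by
  refine ⟨R, R, ((a + x) • (1 : H →L[ℂ] H) - a • P) ∘L R', a • P - (a + x) • (1 : H →L[ℂ] H),
    x * (a + x), mul_ne_zero hx fun h => hxa (by linear_combination h),
    fun f => by simp [hR], fun f => ?_⟩
  simp only [_root_.sub_apply, _root_.smul_apply, ContinuousLinearMap.coe_comp,
    Function.comp_apply, one_apply_eq_self, map_sub, map_smul, hP]
  module

theorem dominates_of_idempotent_perturbation (hR' : ∀ f, P (R' f) = R' f) (hxa : x ≠ -a) :
    Dominates (R' ∘L R - a • P - x • (1 : H →L[ℂ] H))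
      (R ∘L R' - a • (1 : K →L[ℂ] K) - x • (1 : K →L[ℂ] K)) := by
  refine ⟨R', R', R, -1, a + x, fun h => hxa (by linear_combination h),
    fun f => by simp [hR'], fun f => ?_⟩
  simp only [_root_.sub_apply, _root_.smul_apply, _root_.neg_apply, ContinuousLinearMap.coe_comp,
    Function.comp_apply, one_apply_eq_self, map_sub, map_smul]
  module

theorem isClosed_range_of_idempotent_perturbation (hR : ∀ f, R (P f) = R f)
    (hR' : ∀ f, P (R' f) = R' f) (ha : a ≠ 0)
    (h : IsClosed (Set.range (R' ∘L R - a • P))) :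
    IsClosed (Set.range (R ∘L R' - a • (1 : K →L[ℂ] K))) := by
  refine isClosed_range_of_intertwining (d := R') (B := R') (d' := R) (B' := R) (C := 1) h ha
    (fun f => ?_) (fun g => ?_) fun f => ?_
  all_goals simp [hR, hR']

end Idempotent

/-! ### Off-diagonal block operators -/

section OffDiagonal

variable {H K : Type*} [NormedAddCommGroup H] [InnerProductSpace ℂ H]
  [NormedAddCommGroup K] [InnerProductSpace ℂ K]

/-- `(f, g) ↦ R' f + S' g` embeds `K × K` into `H`, and `R` and `S` read off the two coordinates. -/
structure IsBlockPair (R S : H →L[ℂ] K) (R' S' : K →L[ℂ] H) : Prop where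
  fst_fst : ∀ f, R (R' f) = f
  fst_snd : ∀ f, R (S' f) = 0
  snd_fst : ∀ f, S (R' f) = 0
  snd_snd : ∀ f, S (S' f) = f

variable {R S : H →L[ℂ] K} {R' S' : K →L[ℂ] H}

/-- The operator with block matrix `[[0, T], [T', 0]]` on the two copies of `K` in `H` and zero on
the kernel of both coordinates. -/
def offDiagonalOp (R S : H →L[ℂ] K) (R' S' : K →L[ℂ] H) (T T' : K →L[ℂ] K) : H →L[ℂ] H :=
  R' ∘L T ∘L S + S' ∘L T' ∘L R

namespace IsBlockPair

variable {T T' : K →L[ℂ] K} {x : ℂ}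

theorem dominates_offDiagonalOp (h : IsBlockPair R S R' S') (hx : x ≠ 0) :
    Dominates (T ∘L T' - x ^ 2 • (1 : K →L[ℂ] K))
      (offDiagonalOp R S R' S' T T' - x • (1 : H →L[ℂ] H)) := by
  refine ⟨R, R ∘L (offDiagonalOp R S R' S' T T' + x • (1 : H →L[ℂ] H)),
    R' ∘L T ∘L T' + x • (S' ∘L T'), -(R' ∘L T ∘L S) - x • (1 : H →L[ℂ] H), x ^ 2,
    pow_ne_zero 2 hx, fun f => ?_, fun f => ?_⟩
  all_goals
    simp only [offDiagonalOp, _root_.sub_apply, _root_.add_apply, _root_.smul_apply,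
      _root_.neg_apply, ContinuousLinearMap.coe_comp, Function.comp_apply, one_apply_eq_self,
      map_sub, map_add, map_smul, map_zero, h.fst_fst, h.fst_snd, h.snd_fst, h.snd_snd]
    module

theorem dominates_comp (h : IsBlockPair R S R' S') (hx : x ≠ 0) :
    Dominates (offDiagonalOp R S R' S' T T' - x • (1 : H →L[ℂ] H))
      (T ∘L T' - x ^ 2 • (1 : K →L[ℂ] K)) := by
  refine ⟨x • R' + S' ∘L T', R', R, 0, x, hx, fun f => ?_, fun f => ?_⟩
  all_goals
    simp only [offDiagonalOp, _root_.sub_apply, _root_.add_apply, _root_.smul_apply,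
      _root_.zero_apply, ContinuousLinearMap.coe_comp, Function.comp_apply, one_apply_eq_self,
      map_sub, map_add, map_smul, map_zero, h.fst_fst, h.fst_snd, h.snd_fst, h.snd_snd]
    module

end IsBlockPair

end OffDiagonal

/-! ### Translations of an abelian group -/

section Translations

open Filter Topology
open scoped Pointwise

/-- The pullback `ℓ²(Y) → ℓ²(X)` along an injective map `X → Y`. -/
def pullbackOp {X Y : Type*} (φ : X → Y) (hφ : Function.Injective φ) :
    EllTwo Y →L[ℂ] EllTwo X :=
  mkContraction (fun f x => f (φ x)) (fun _ _ => rfl) (fun _ _ => rfl) (by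
    intro f s
    rw [EllTwo.norm_sq]
    refine le_trans ?_ ((EllTwo.summable f).sum_le_tsum (s.map ⟨φ, hφ⟩) fun _ _ => by positivity)
    rw [Finset.sum_map]
    rfl)

@[simp]
theorem pullbackOp_apply {X Y : Type*} (φ : X → Y) (hφ : Function.Injective φ) (f : EllTwo Y)
    (x : X) : pullbackOp φ hφ f x = f (φ x) := rfl

theorem adjoint_pullbackOp_equiv {X Y : Type*} (φ : X ≃ Y) :
    (pullbackOp φ φ.injective).adjoint = pullbackOp φ.symm φ.symm.injective := by
  refine ((ContinuousLinearMap.eq_adjoint_iff _ _).mpr fun f g => ?_).symm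
  rw [lp.inner_eq_tsum, lp.inner_eq_tsum, ← φ.tsum_eq]
  simp

open Classical in
theorem pullbackOp_single {X Y : Type*} {φ : X → Y} (hφ : Function.Injective φ) (x : X) :
    pullbackOp φ hφ (lp.single 2 (φ x) 1) = lp.single 2 x 1 := by
  ext w
  rw [pullbackOp_apply, lp.single_apply, lp.single_apply, Pi.single_apply, Pi.single_apply]
  simp only [hφ.eq_iff]

theorem adjoint_pullbackOp_apply {X Y : Type*} {φ : X → Y} (hφ : Function.Injective φ)
    (f : EllTwo X) (x : X) : (pullbackOp φ hφ).adjoint f (φ x) = f x := by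
  classical
  have hcoord : (pullbackOp φ hφ).adjoint f (φ x)
      = ⟪lp.single 2 (φ x) (1 : ℂ), (pullbackOp φ hφ).adjoint f⟫_ℂ := by
    rw [lp.inner_single_left]; simp
  rw [hcoord, ContinuousLinearMap.adjoint_inner_right, pullbackOp_single, lp.inner_single_left]
  simp

theorem adjoint_pullbackOp_apply_of_notMem {X Y : Type*} {φ : X → Y} (hφ : Function.Injective φ)
    (f : EllTwo X) {y : Y} (hy : y ∉ Set.range φ) : (pullbackOp φ hφ).adjoint f y = 0 := by
  classical
  have hcoord : (pullbackOp φ hφ).adjoint f y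
      = ⟪lp.single 2 y (1 : ℂ), (pullbackOp φ hφ).adjoint f⟫_ℂ := by
    rw [lp.inner_single_left]; simp
  have hzero : pullbackOp φ hφ (lp.single 2 y 1) = 0 := by
    ext w
    rw [pullbackOp_apply, lp.single_apply, Pi.single_eq_of_ne fun h => hy ⟨w, h⟩]
    rfl
  rw [hcoord, ContinuousLinearMap.adjoint_inner_right, hzero, inner_zero_left]

theorem EllTwo.tendsto_cofinite_zero {X : Type*} (f : EllTwo X) : Tendsto f cofinite (𝓝 0) := by
  rw [tendsto_zero_iff_norm_tendsto_zero]
  simpa [Real.sqrt_sq (norm_nonneg _)] using (EllTwo.summable f).tendsto_cofinite_zero.sqrt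

variable {G : Type*} [AddCommGroup G]

/-- The translation `(τ_h f)(g) = f (g + h)`. -/
def transOp (h : G) : EllTwo G →L[ℂ] EllTwo G :=
  pullbackOp (Equiv.addRight h) (Equiv.addRight h).injective

@[simp]
theorem transOp_apply (h : G) (f : EllTwo G) (g : G) : transOp h f g = f (g + h) := rfl

theorem adjoint_transOp (h : G) : (transOp h).adjoint = transOp (-h) := by
  rw [transOp, adjoint_pullbackOp_equiv]
  ext f g
  simp

theorem transOp_mul_transOp (a b : G) : transOp a * transOp b = transOp (a + b) := by
  ext f g
  simp [add_assoc]

theorem transOp_transOp (a b : G) (f : EllTwo G) : transOp a (transOp b f) = transOp (a + b) f :=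
  DFunLike.congr_fun (transOp_mul_transOp a b) f

theorem transOp_zero : transOp (0 : G) = 1 := by
  ext f g
  simp

theorem commute_transOp (a b : G) : Commute (transOp a) (transOp b) := by
  rw [commute_iff_eq, transOp_mul_transOp, transOp_mul_transOp, add_comm]

theorem norm_transOp (h : G) (f : EllTwo G) : ‖transOp h f‖ = ‖f‖ := by
  refine (sq_eq_sq₀ (norm_nonneg _) (norm_nonneg _)).mp ?_
  rw [EllTwo.norm_sq, EllTwo.norm_sq]
  exact (Equiv.addRight h).tsum_eq fun g => ‖f g‖ ^ 2

theorem eq_zero_of_transOp_eq_smul {h : G} (hh : addOrderOf h = 0) {f : EllTwo G} {β : ℂ}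
    (hf : transOp h f = β • f) : f = 0 := by
  by_contra hf0
  have hβ : ‖β‖ = 1 := by
    have := norm_transOp h f
    rwa [hf, norm_smul, mul_eq_right₀ (norm_ne_zero_iff.mpr hf0)] at this
  have hiter (g : G) (n : ℕ) : ‖f (g + n • h)‖ = ‖f g‖ := by
    induction n with
    | zero => simp
    | succ n ih =>
      have hstep : f (g + n • h + h) = β * f (g + n • h) := congrArg (fun u : EllTwo G => u _) hf
      rw [succ_nsmul, ← add_assoc, hstep, norm_mul, hβ, one_mul, ih]
  refine hf0 (lp.ext (funext fun g => norm_eq_zero.mp ?_))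
  have hinj : Function.Injective fun n : ℕ => g + n • h :=
    (add_right_injective g).comp (injective_nsmul_iff_not_isOfFinAddOrder.mpr
      (addOrderOf_eq_zero_iff.mp hh))
  refine tendsto_nhds_unique (f := fun n : ℕ => ‖f (g + n • h)‖) (l := atTop) ?_ ?_
  · simpa only [hiter] using tendsto_const_nhds
  · simpa [Nat.cofinite_eq_atTop] using
      ((EllTwo.tendsto_cofinite_zero f).comp hinj.tendsto_cofinite).norm

theorem eq_zero_of_quadratic_transOp {h : G} (hh : addOrderOf h = 0) {f : EllTwo G} {a b c : ℂ}
    (ha : a ≠ 0) (hf : a • transOp h (transOp h f) + b • transOp h f + c • f = 0) : f = 0 := by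
  obtain ⟨s, hs⟩ := IsAlgClosed.exists_pow_nat_eq (discrim a b c) two_pos
  obtain ⟨α, hα⟩ := exists_quadratic_eq_zero ha ⟨s, by rw [← hs, sq]⟩
  refine eq_zero_of_transOp_eq_smul hh (β := α) (sub_eq_zero.mp ?_)
  refine eq_zero_of_transOp_eq_smul hh (β := -b / a - α) (smul_right_injective _ ha ?_)
  have hβ : a * (-b / a - α) = -b - a * α := by field_simp
  simp only [map_sub, map_smul, smul_smul a, hβ]
  linear_combination (norm := module) hf - hα • f

variable [DecidableEq G]

/-- The character `χ` cut off to the finite set `s`: an approximate eigenvector of all translations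
under which `s` is almost invariant. -/
def planeWave (χ : AddChar G Circle) (s : Finset G) : EllTwo G :=
  ∑ g ∈ s, lp.single 2 g (χ g : ℂ)

theorem norm_planeWave_sq (χ : AddChar G Circle) (s : Finset G) :
    ‖planeWave χ s‖ ^ 2 = s.card := by
  have := lp.norm_sum_single (p := 2) (E := fun _ : G => ℂ) (by norm_num) (fun g => (χ g : ℂ)) s
  simpa [planeWave, Circle.norm_coe] using this

theorem planeWave_apply (χ : AddChar G Circle) (s : Finset G) (g : G) :
    planeWave χ s g = if g ∈ s then (χ g : ℂ) else 0 := by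
  rw [planeWave, lp.coeFn_sum, Finset.sum_apply]
  simp [Pi.single_apply]

theorem norm_transOp_planeWave_sub_sq (χ : AddChar G Circle) (s : Finset G) (h : G) :
    ‖transOp h (planeWave χ s) - (χ h : ℂ) • planeWave χ s‖ ^ 2 = (symmDiff (-h +ᵥ s) s).card := by
  have hmem (g : G) : g ∈ -h +ᵥ s ↔ g + h ∈ s := by
    rw [← Finset.neg_vadd_mem_iff, neg_neg, vadd_eq_add, add_comm]
  have hval (g : G) : ‖(transOp h (planeWave χ s) - (χ h : ℂ) • planeWave χ s : EllTwo G) g‖ ^ 2 =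
      if g ∈ symmDiff (-h +ᵥ s) s then 1 else 0 := by
    simp only [lp.coeFn_sub, lp.coeFn_smul, Pi.sub_apply, Pi.smul_apply, transOp_apply,
      planeWave_apply, Finset.mem_symmDiff, hmem]
    by_cases h1 : g + h ∈ s <;> by_cases h2 : g ∈ s <;>
      simp [h1, h2, AddChar.map_add_eq_mul, mul_comm, Circle.norm_coe]
  simp only [EllTwo.norm_sq, hval]
  rw [tsum_eq_sum (s := symmDiff (-h +ᵥ s) s) fun g hg => if_neg hg, Finset.sum_ite_mem]
  simp

end Translations

/-! ### The incidence operator of the triangles -/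

section Lattice

open scoped Pointwise

/-- The operator `T = 1 + τ_{(-1,0)} + τ_{(0,1)}`. Both triangle-to-triangle adjacency and the graph
Laplacian of the cylinder are expressed through `T`. -/
def triOp : EllTwo (ZMod 3 × ℤ) →L[ℂ] EllTwo (ZMod 3 × ℤ) :=
  1 + transOp (-1, 0) + transOp (0, 1)

theorem triOp_apply (v : EllTwo (ZMod 3 × ℤ)) (g : ZMod 3 × ℤ) :
    triOp v g = v g + v (g + (-1, 0)) + v (g + (0, 1)) := rfl

theorem adjoint_triOp : triOp.adjoint = 1 + transOp (1, 0) + transOp (0, -1) := by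
  rw [triOp, map_add, map_add, adjoint_transOp, adjoint_transOp,
    ContinuousLinearMap.adjoint_one]
  norm_num

theorem adjoint_triOp_apply (v : EllTwo (ZMod 3 × ℤ)) (g : ZMod 3 × ℤ) :
    triOp.adjoint v g = v g + v (g + (1, 0)) + v (g + (0, -1)) := by
  rw [adjoint_triOp]; rfl

theorem commute_triOp_transOp (h : ZMod 3 × ℤ) : Commute triOp (transOp h) :=
  (((Commute.one_left _).add_left (commute_transOp _ h)).add_left (commute_transOp _ h))

theorem commute_adjoint_triOp_transOp (h : ZMod 3 × ℤ) : Commute triOp.adjoint (transOp h) := by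
  rw [adjoint_triOp]
  exact (((Commute.one_left _).add_left (commute_transOp _ h)).add_left (commute_transOp _ h))

theorem isStarNormal_triOp : IsStarNormal triOp := by
  refine ⟨?_⟩
  rw [ContinuousLinearMap.star_eq_adjoint, adjoint_triOp]
  exact ((Commute.one_left _).add_left (commute_triOp_transOp _).symm).add_left
    (commute_triOp_transOp _).symm

theorem norm_triOp_le : ‖triOp‖ ≤ 3 := by
  refine ContinuousLinearMap.opNorm_le_bound _ (by norm_num) fun v => ?_
  have h : triOp v = v + transOp (-1, 0) v + transOp (0, 1) v := rfl
  calc ‖triOp v‖ ≤ ‖v‖ + ‖transOp (-1, 0) v‖ + ‖transOp (0, 1) v‖ := h ▸ norm_add₃_le ..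
    _ = 3 * ‖v‖ := by rw [norm_transOp, norm_transOp]; ring

/-- The positive operator `N = T T*`; `9 - N` is the graph Laplacian of the cylinder. -/
def latticeOp : EllTwo (ZMod 3 × ℤ) →L[ℂ] EllTwo (ZMod 3 × ℤ) :=
  triOp ∘L triOp.adjoint

theorem isStarNormal_latticeOp : IsStarNormal latticeOp :=
  (IsSelfAdjoint.mul_star_self triOp).isStarNormal

theorem eq_zero_of_latticeOp_of_transOp_eq_smul {w : EllTwo (ZMod 3 × ℤ)} {ζ x : ℂ}
    (hζ : ζ ^ 3 = 1) (hw : transOp (1, 0) w = ζ • w) (hN : latticeOp w = x • w) : w = 0 := by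
  have hw' : transOp (-1, 0) w = ζ ^ 2 • w := by
    have h2 : transOp (1, 0) (transOp (1, 0) w) = transOp (-1, 0) w := by
      rw [transOp_transOp]; rfl
    rw [← h2, hw, map_smul, hw, smul_smul, sq]
  have hlead : 1 + ζ ≠ 0 := fun h0 => by
    have h1 : ζ = -1 := by linear_combination h0
    norm_num [h1] at hζ
  have hT : triOp w = (1 + ζ ^ 2) • w + transOp (0, 1) w := by
    simp only [triOp, _root_.add_apply, one_apply_eq_self, hw']
    module
  have hT' : transOp (0, 1) (triOp.adjoint w) = (1 + ζ) • transOp (0, 1) w + w := by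
    have hcancel : transOp (0, 1) (transOp (0, -1) w) = w := by
      rw [transOp_transOp, show ((0, 1) + (0, -1) : ZMod 3 × ℤ) = 0 from rfl, transOp_zero,
        one_apply_eq_self]
    simp only [adjoint_triOp, _root_.add_apply, one_apply_eq_self, hw, map_add, map_smul, hcancel]
    module
  have hcomm (h : ZMod 3 × ℤ) (u : EllTwo (ZMod 3 × ℤ)) :
      triOp (transOp h u) = transOp h (triOp u) := DFunLike.congr_fun (commute_triOp_transOp h) u
  have hquad : triOp (transOp (0, 1) (triOp.adjoint w)) = x • transOp (0, 1) w := by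
    rw [hcomm, ← map_smul, ← hN]
    rfl
  refine eq_zero_of_quadratic_transOp (h := ((0, 1) : ZMod 3 × ℤ)) ?_ hlead
    (b := (1 + ζ) * (1 + ζ ^ 2) + 1 - x) (c := 1 + ζ ^ 2) ?_
  · exact addOrderOf_eq_zero_iff'.mpr fun n hn h => by simp [hn.ne'] at h
  · rw [hT', map_add, map_smul, hcomm, hT] at hquad
    simp only [map_add, map_smul] at hquad
    linear_combination (norm := module) hquad

theorem exists_circle_sq_add_self_add_one_eq_zero : ∃ ω : Circle, (ω ^ 2 + ω + 1 : ℂ) = 0 := by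
  have := (Complex.isPrimitiveRoot_exp 3 three_ne_zero).geom_sum_eq_zero (by norm_num)
  refine ⟨Circle.exp (2 * Real.pi / 3), ?_⟩
  simp only [Finset.sum_range_succ, Finset.sum_range_zero, pow_zero, pow_one] at this
  rw [Circle.coe_exp]
  push_cast at this ⊢
  rw [div_mul_eq_mul_div]
  linear_combination this

theorem pointSpectrum_latticeOp : pointSpectrum latticeOp = ∅ := by
  refine Set.eq_empty_of_forall_notMem fun x => notMem_pointSpectrum.mpr fun v hv => ?_
  obtain ⟨ω, hω⟩ := exists_circle_sq_add_self_add_one_eq_zero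
  have hω3 : (ω : ℂ) ^ 3 = 1 := by linear_combination (ω - 1) * hω
  have hcube : transOp (1, 0) (transOp (1, 0) (transOp (1, 0) v)) = v := by
    rw [transOp_transOp, transOp_transOp,
      show ((1, 0) + (1, 0) + (1, 0) : ZMod 3 × ℤ) = 0 from rfl, transOp_zero, one_apply_eq_self]
  have hcomm (u : EllTwo (ZMod 3 × ℤ)) :
      latticeOp (transOp (1, 0) u) = transOp (1, 0) (latticeOp u) :=
    DFunLike.congr_fun
      ((commute_triOp_transOp (1, 0)).mul_left (commute_adjoint_triOp_transOp (1, 0))) u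
  have hcomponent (ζ : ℂ) (hζ : ζ ^ 3 = 1) :
      v + ζ ^ 2 • transOp (1, 0) v + ζ • transOp (1, 0) (transOp (1, 0) v) = 0 := by
    refine eq_zero_of_latticeOp_of_transOp_eq_smul (x := x) hζ ?_ ?_
    · simp only [map_add, map_smul, hcube]
      linear_combination (norm := module) -hζ • transOp (1, 0) v
    · simp only [map_add, map_smul, hcomm, hv]
      module
  have h1 := hcomponent 1 (one_pow 3)
  have h2 := hcomponent ω hω3
  have h3 := hcomponent (ω ^ 2) (by linear_combination (ω ^ 3 + 1) * hω3)
  have h : (3 : ℂ) • v = 0 := by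
    linear_combination (norm := module) h1 + h2 + h3 - hω • transOp (1, 0) v -
      hω • transOp (1, 0) (transOp (1, 0) v) - ((ω : ℂ) • hω3) • transOp (1, 0) v
  exact (smul_eq_zero.mp h).resolve_left three_ne_zero

theorem exists_addChar {ζ : Circle} (hζ : ζ ^ 3 = 1) (z : Circle) :
    ∃ χ : AddChar (ZMod 3 × ℤ) Circle, χ (-1, 0) = ζ ∧ χ (0, 1) = z := by
  have hζ' : (ζ⁻¹) ^ 3 = 1 := by rw [inv_pow, hζ, inv_one]
  refine ⟨{ toFun := fun g => AddChar.zmodChar 3 hζ' g.1 * z ^ g.2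
            map_zero_eq_one' := by simp
            map_add_eq_mul' := fun g h => ?_ }, ?_, ?_⟩
  · simp only [Prod.fst_add, Prod.snd_add, AddChar.map_add_eq_mul, zpow_add]
    exact mul_mul_mul_comm ..
  · simpa [AddChar.zmodChar_apply] using (eq_inv_of_mul_eq_one_right (a := ζ ^ 2) (by
      rw [← pow_succ, hζ])).symm
  · simp

theorem card_symmDiff_vadd_le (N : ℕ) :
    (symmDiff (-((0, 1) : ZMod 3 × ℤ) +ᵥ (Finset.univ ×ˢ Finset.Ico 0 (N : ℤ)))
      (Finset.univ ×ˢ Finset.Ico 0 (N : ℤ) : Finset (ZMod 3 × ℤ))).card ≤ 6 := by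
  refine (Finset.card_le_card (t := Finset.univ ×ˢ {-1, (N : ℤ) - 1}) fun g hg => ?_).trans ?_
  · simp only [Finset.mem_symmDiff, Finset.mem_neg_vadd_finset_iff, Finset.mem_product,
      Finset.mem_univ, true_and, Finset.mem_Ico, Finset.mem_insert, Finset.mem_singleton,
      vadd_eq_add, Prod.snd_add] at hg ⊢
    omega
  · rw [Finset.card_product, Finset.card_univ, ZMod.card]
    exact Nat.mul_le_mul_left 3 Finset.card_le_two

theorem mem_spectrum_triOp {ζ : Circle} (hζ : ζ ^ 3 = 1) (z : Circle) :
    (1 + ζ + z : ℂ) ∈ spectrum ℂ triOp := by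
  by_contra hmem
  obtain ⟨c, hc⟩ := (notMem_spectrum_iff_isBoundedBelow isStarNormal_triOp).mp hmem
  obtain ⟨χ, rfl, rfl⟩ := exists_addChar hζ z
  obtain ⟨N, hN⟩ := exists_nat_gt (c ^ 2 * 2)
  set w := planeWave χ (Finset.univ ×ˢ Finset.Ico 0 (N : ℤ)) with hw
  have hw_norm : ‖w‖ ^ 2 = 3 * N := by simp [hw, norm_planeWave_sq]
  have hhorizontal : transOp (-1, 0) w - (χ (-1, 0) : ℂ) • w = 0 := by
    rw [← norm_eq_zero, ← sq_eq_zero_iff, norm_transOp_planeWave_sub_sq, Nat.cast_eq_zero,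
      Finset.card_eq_zero, Finset.symmDiff_eq_empty]
    ext g
    rw [Finset.mem_neg_vadd_finset_iff]
    simp
  have hvertical : ‖transOp (0, 1) w - (χ (0, 1) : ℂ) • w‖ ^ 2 ≤ 6 := by
    rw [norm_transOp_planeWave_sub_sq]
    exact_mod_cast card_symmDiff_vadd_le N
  have hsub : (triOp - (1 + χ (-1, 0) + χ (0, 1) : ℂ) • 1) w =
      transOp (0, 1) w - (χ (0, 1) : ℂ) • w := by
    simp only [triOp, _root_.sub_apply, _root_.add_apply, _root_.smul_apply, one_apply_eq_self]
    linear_combination (norm := module) hhorizontal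
  have hbound : ‖w‖ ^ 2 ≤ c ^ 2 * 6 := calc
    ‖w‖ ^ 2 ≤ (c * ‖transOp (0, 1) w - (χ (0, 1) : ℂ) • w‖) ^ 2 := by
      gcongr
      exact hsub ▸ hc w
    _ ≤ c ^ 2 * 6 := by
      rw [mul_pow]
      gcongr
  linarith

theorem exists_norm_sq_eq {x : ℝ} (hx : x ∈ Set.Icc 0 9) :
    ∃ ζ z : Circle, ζ ^ 3 = 1 ∧ ‖(1 + ζ + z : ℂ)‖ ^ 2 = x := by
  have hrange (ζ z₀ z₁ : Circle) (h₀ : ‖(1 + ζ + z₀ : ℂ)‖ ^ 2 ≤ x)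
      (h₁ : x ≤ ‖(1 + ζ + z₁ : ℂ)‖ ^ 2) : ∃ z : Circle, ‖(1 + ζ + z : ℂ)‖ ^ 2 = x :=
    mem_range_of_exists_le_of_exists_ge (by fun_prop) ⟨z₀, h₀⟩ ⟨z₁, h₁⟩
  rcases le_total x 4 with h4 | h4
  · obtain ⟨ω, hω⟩ := exists_circle_sq_add_self_add_one_eq_zero
    have hlow : (1 + ω + (ω ^ 2 : Circle) : ℂ) = 0 := by
      push_cast
      linear_combination hω
    have hhigh : ‖(1 + ω + (-ω ^ 2 : Circle) : ℂ)‖ = 2 := by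
      have : (1 + ω + (-ω ^ 2 : Circle) : ℂ) = -2 * ω ^ 2 := by
        push_cast
        linear_combination hω
      rw [this]
      simp [Circle.norm_coe]
    obtain ⟨z, hz⟩ := hrange ω (ω ^ 2) (-ω ^ 2) (by rw [hlow]; simpa using hx.1)
      (by rw [hhigh]; linarith)
    refine ⟨ω, z, Circle.ext ?_, hz⟩
    push_cast
    linear_combination (ω - 1 : ℂ) * hω
  · obtain ⟨z, hz⟩ := hrange 1 (-1) 1 (by norm_num; linarith) (by norm_num; exact hx.2)
    exact ⟨1, z, one_pow 3, hz⟩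

theorem spectrum_latticeOp : spectrum ℂ latticeOp = Complex.ofReal '' Set.Icc 0 9 := by
  have := isStarNormal_triOp
  have hN : latticeOp = cfc (fun z : ℂ => z * star z) triOp := by
    rw [cfc_mul .., cfc_star .., cfc_id' ..]
    rfl
  rw [hN, cfc_map_spectrum _ _]
  ext w
  simp only [Set.mem_image]
  constructor
  · rintro ⟨z, hz, rfl⟩
    refine ⟨‖z‖ ^ 2, ⟨by positivity, ?_⟩, by simpa using (Complex.mul_conj' z).symm⟩
    have : ‖z‖ ≤ 3 := calc
      ‖z‖ ≤ ‖triOp‖ * ‖(1 : EllTwo (ZMod 3 × ℤ) →L[ℂ] EllTwo (ZMod 3 × ℤ))‖ :=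
        spectrum.norm_le_norm_mul_of_mem hz
      _ ≤ 3 * 1 := by gcongr; exacts [norm_triOp_le, ContinuousLinearMap.norm_id_le]
      _ = 3 := mul_one 3
    nlinarith [norm_nonneg z]
  · rintro ⟨x, hx, rfl⟩
    obtain ⟨ζ, z, hζ, rfl⟩ := exists_norm_sq_eq hx
    exact ⟨_, mem_spectrum_triOp hζ z, by simpa using Complex.mul_conj' (1 + ζ + z : ℂ)⟩

end Lattice

section Adjacency

/-- The differences of adjacent vertices of the cylinder. -/
def adjVec : Finset (ZMod 3 × ℤ) := {(1, 0), (-1, 0), (0, 1), (0, -1), (1, 1), (-1, -1)}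

theorem sum_adjVec {M : Type*} [AddCommMonoid M] (F : ZMod 3 × ℤ → M) :
    ∑ δ ∈ adjVec, F δ = F (1, 0) + (F (-1, 0) + (F (0, 1) + (F (0, -1) + (F (1, 1) +
      F (-1, -1))))) := by
  unfold adjVec
  rw [Finset.sum_insert (by decide), Finset.sum_insert (by decide), Finset.sum_insert (by decide),
    Finset.sum_insert (by decide), Finset.sum_insert (by decide), Finset.sum_singleton]

theorem neg_mem_adjVec {δ : ZMod 3 × ℤ} (h : δ ∈ adjVec) : -δ ∈ adjVec := by
  revert δ
  unfold adjVec
  decide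

theorem latticeOp_apply (v : EllTwo (ZMod 3 × ℤ)) (g : ZMod 3 × ℤ) :
    latticeOp v g = 3 * v g + ∑ δ ∈ adjVec, v (g + δ) := by
  have h0 : g + ((0, 0) : ZMod 3 × ℤ) = g := add_zero g
  rw [latticeOp, ContinuousLinearMap.comp_apply, triOp_apply, sum_adjVec]
  simp only [adjoint_triOp_apply, add_assoc, Prod.mk_add_mk]
  norm_num [h0]
  ring

end Adjacency

/-! ### Signs of faces -/

section Signs

section FacePerm

variable {p : ℕ} {j j' : Fin (p + 2)} {ρ : Equiv.Perm (Fin (p + 1))}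

/-- The permutation that carries `j'` to `j` and acts as `ρ` between the complements of these
points, both identified with `Fin (p + 1)` by `Fin.succAbove`. -/
def facePerm (j j' : Fin (p + 2)) (ρ : Equiv.Perm (Fin (p + 1))) : Equiv.Perm (Fin (p + 2)) :=
  j.cycleRange.symm * Equiv.Perm.decomposeFin.symm (0, ρ) * j'.cycleRange

theorem facePerm_succAbove (i : Fin (p + 1)) :
    facePerm j j' ρ (j'.succAbove i) = j.succAbove (ρ i) := by
  simp [facePerm]

theorem facePerm_self : facePerm j j' ρ j' = j := by
  simp [facePerm]

theorem sign_facePerm : sign (facePerm j j' ρ) = (-1) ^ (j : ℕ) * sign ρ * (-1) ^ (j' : ℕ) := by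
  simp only [facePerm, Equiv.Perm.sign_mul, Equiv.Perm.sign_symm, Fin.sign_cycleRange,
    Equiv.Perm.decomposeFin.symm_sign, if_true, one_mul]

theorem sign_eq_of_succAbove {π : Equiv.Perm (Fin (p + 2))}
    (h : ∀ i, j.succAbove (ρ i) = π (j'.succAbove i)) :
    sign π = (-1) ^ (j : ℕ) * sign ρ * (-1) ^ (j' : ℕ) := by
  have hj : π j' = j := by
    by_contra hne
    obtain ⟨k, hk⟩ := Fin.exists_succAbove_eq hne
    obtain ⟨i, rfl⟩ := ρ.surjective k
    rw [h] at hk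
    exact Fin.succAbove_ne _ _ (π.injective hk)
  have hπ : π = facePerm j j' ρ := by
    ext1 i
    obtain rfl | ⟨i, rfl⟩ := Fin.eq_self_or_eq_succAbove j' i
    · rw [hj, facePerm_self]
    · rw [← h, facePerm_succAbove]
  rw [hπ, sign_facePerm]

theorem exists_sign_facePerm_eq_one (j : Fin (p + 2)) (ρ : Equiv.Perm (Fin (p + 1))) :
    ∃ j', sign (facePerm j j' ρ) = 1 := by
  simp only [sign_facePerm]
  rcases Int.units_eq_one_or ((-1 : ℤˣ) ^ (j : ℕ) * sign ρ) with h | h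
  · exact ⟨0, by simp [h]⟩
  · exact ⟨1, by simp [h]⟩

end FacePerm

variable {V : Type*} {K : AbstractSimplicialComplex V} {p : ℕ}

namespace OrderedSimplex

theorem perm_perm {q : ℕ} (s : OrderedSimplex K q) (π ρ : Equiv.Perm (Fin (q + 1))) :
    (s.perm π).perm ρ = s.perm (π * ρ) := rfl

theorem oriented_eq_iff {q : ℕ} {s t : OrderedSimplex K q} :
    s.oriented = t.oriented ↔ ∃ π : Equiv.Perm (Fin (q + 1)), sign π = 1 ∧ t = s.perm π :=
  Quotient.eq

theorem sign_eq_of_perm_face {s : OrderedSimplex K (p + 1)} {π : Equiv.Perm (Fin (p + 2))}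
    {j j' : Fin (p + 2)} {ρ ρ' : Equiv.Perm (Fin (p + 1))}
    (h : (s.face j).perm ρ = ((s.perm π).face j').perm ρ') :
    sign π = (-1) ^ (j : ℕ) * (sign ρ * sign ρ') * (-1) ^ (j' : ℕ) := by
  rw [← Equiv.Perm.sign_inv ρ', ← Equiv.Perm.sign_mul]
  refine sign_eq_of_succAbove fun i => s.injective ?_
  simpa [perm, face] using congrFun (congrArg vertex h) (ρ'⁻¹ i)

theorem neg_one_pow_eq_of_face_oriented {s s' : OrderedSimplex K (p + 1)} {j j' : Fin (p + 2)}
    {ρ : Equiv.Perm (Fin (p + 1))} (hs : s'.oriented = s.oriented)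
    (hface : (s'.face j').oriented = ((s.face j).perm ρ).oriented) :
    (-1 : ℤˣ) ^ (j' : ℕ) = sign ρ * (-1) ^ (j : ℕ) := by
  obtain ⟨π, hπ, rfl⟩ := oriented_eq_iff.mp hs
  obtain ⟨κ, hκ, hκface⟩ := oriented_eq_iff.mp hface
  have hsign := sign_eq_of_perm_face hκface.symm
  rw [hπ, hκ, one_mul, mul_assoc, eq_comm, mul_eq_one_iff_eq_inv, Int.units_inv_eq_self] at hsign
  exact hsign

theorem sgn_perm_face (s : OrderedSimplex K (p + 1)) (j : Fin (p + 2))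
    (ρ : Equiv.Perm (Fin (p + 1))) :
    sgn s.oriented ((s.face j).perm ρ).oriented = (sign ρ * (-1) ^ (j : ℕ) : ℤˣ) := by
  obtain ⟨j', hπ⟩ := exists_sign_facePerm_eq_one j ρ
  have hs : (s.perm (facePerm j j' ρ)).oriented = s.oriented :=
    (oriented_eq_iff.mpr ⟨_, hπ, rfl⟩).symm
  have hface : ((s.perm (facePerm j j' ρ)).face j').oriented = ((s.face j).perm ρ).oriented :=
    congrArg oriented (ext_vertex (funext fun i => by simp [perm, face, facePerm_succAbove]))
  rw [← neg_one_pow_eq_of_face_oriented hs hface, sgn]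
  rcases Nat.even_or_odd (j' : ℕ) with he | ho
  · rw [if_pos ⟨_, _, hs, hface, he⟩, he.neg_one_pow, Units.val_one]
  · rw [if_neg, if_pos ⟨_, _, hs, hface, ho⟩, ho.neg_one_pow, Units.val_neg, Units.val_one]
    rintro ⟨s', j'', hs', hface', he⟩
    have hparity := neg_one_pow_eq_of_face_oriented (ρ := 1) (hs.trans hs'.symm)
      (hface.trans hface'.symm)
    rw [Equiv.Perm.sign_one, one_mul, ho.neg_one_pow, he.neg_one_pow] at hparity
    exact absurd hparity (by decide)

theorem sgn_eq_of_vertex {s : OrderedSimplex K (p + 1)} {t : OrderedSimplex K p} (j : Fin (p + 2))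
    (ρ : Equiv.Perm (Fin (p + 1))) (h : ∀ i, t.vertex i = s.vertex (j.succAbove (ρ i))) :
    sgn s.oriented t.oriented = (sign ρ * (-1) ^ (j : ℕ) : ℤˣ) := by
  have : t = (s.face j).perm ρ := ext_vertex (funext h)
  rw [this, sgn_perm_face]

theorem exists_perm {q : ℕ} {s t : OrderedSimplex K q} (h : t.support ⊆ s.support) :
    ∃ π, t = s.perm π := by
  have hvertex (i : Fin (q + 1)) : ∃ j, s.vertex j = t.vertex i :=
    (mem_support _ _).mp (h ((mem_support _ _).mpr ⟨i, rfl⟩))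
  choose f hf using hvertex
  have hinj : Function.Injective f := fun i j hij => t.injective (by rw [← hf, ← hf, hij])
  exact ⟨Equiv.ofBijective f (Finite.injective_iff_bijective.mp hinj),
    ext_vertex (funext fun i => (hf i).symm)⟩

theorem exists_face {s : OrderedSimplex K (p + 1)} {t : OrderedSimplex K p}
    (h : t.support ⊆ s.support) : ∃ j ρ, t = (s.face j).perm ρ := by
  have hcard : t.support.card < s.support.card := by simp [support]
  obtain ⟨v, hvs, hvt⟩ := Finset.exists_mem_notMem_of_card_lt_card hcard
  obtain ⟨j, rfl⟩ := (mem_support _ _).mp hvs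
  refine ⟨j, exists_perm fun w hw => ?_⟩
  obtain ⟨k, rfl⟩ := (mem_support _ _).mp (h hw)
  have hkj : k ≠ j := by rintro rfl; exact hvt hw
  obtain ⟨i, rfl⟩ := Fin.exists_succAbove_eq hkj
  exact (mem_support _ _).mpr ⟨i, rfl⟩

theorem sgn_perm_left {s : OrderedSimplex K (p + 1)} {t : OrderedSimplex K p}
    (h : t.support ⊆ s.support) (π : Equiv.Perm (Fin (p + 2))) :
    sgn (s.perm π).oriented t.oriented = sign π * sgn s.oriented t.oriented := by
  obtain ⟨j, ρ, rfl⟩ := exists_face h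
  obtain ⟨j', ρ', h'⟩ := exists_face (s := s.perm π) (t := (s.face j).perm ρ)
    (by rw [s.support_perm]; exact h)
  rw [sgn_perm_face, sign_eq_of_perm_face h', h', sgn_perm_face, ← Units.val_mul]
  congr 1
  generalize (-1 : ℤˣ) ^ (j : ℕ) = a, (-1 : ℤˣ) ^ (j' : ℕ) = b, sign ρ = c, sign ρ' = d
  decide +revert

theorem sgn_perm_right {s : OrderedSimplex K (p + 1)} {t : OrderedSimplex K p}
    (h : t.support ⊆ s.support) (κ : Equiv.Perm (Fin (p + 1))) :
    sgn s.oriented (t.perm κ).oriented = sign κ * sgn s.oriented t.oriented := by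
  obtain ⟨j, ρ, rfl⟩ := exists_face h
  rw [perm_perm, sgn_perm_face, sgn_perm_face, Equiv.Perm.sign_mul]
  push_cast
  ring

end OrderedSimplex

namespace OrientedSimplex

theorem sgn_mul_self {τ : OrientedSimplex K (p + 1)} {μ : OrientedSimplex K p}
    (h : μ.support ⊆ τ.support) : sgn τ μ * sgn τ μ = 1 := by
  obtain ⟨s, rfl⟩ := τ.exists_rep
  obtain ⟨t, rfl⟩ := μ.exists_rep
  obtain ⟨j, ρ, rfl⟩ := OrderedSimplex.exists_face h
  rw [OrderedSimplex.sgn_perm_face, Int.units_coe_mul_self]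

theorem sgn_mul_sgn {τ τ' : OrientedSimplex K (p + 1)} {μ μ' : OrientedSimplex K p}
    (hμ : μ'.support = μ.support) (h : μ.support ⊆ τ.support) (h' : μ.support ⊆ τ'.support) :
    sgn τ μ' * sgn τ' μ' = sgn τ μ * sgn τ' μ := by
  obtain ⟨s, rfl⟩ := τ.exists_rep
  obtain ⟨s', rfl⟩ := τ'.exists_rep
  obtain ⟨t, rfl⟩ := μ.exists_rep
  obtain ⟨t', rfl⟩ := μ'.exists_rep
  obtain ⟨κ, rfl⟩ := OrderedSimplex.exists_perm hμ.subset
  rw [OrderedSimplex.sgn_perm_right h, OrderedSimplex.sgn_perm_right h', mul_mul_mul_comm,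
    Int.units_coe_mul_self, one_mul]

/-- The same simplex with the opposite orientation. -/
def flip (τ : OrientedSimplex K (p + 1)) : OrientedSimplex K (p + 1) :=
  Quotient.map (fun s => s.perm (Equiv.swap 0 1)) (by
    rintro s _ ⟨π, hπ, rfl⟩
    refine ⟨Equiv.swap 0 1 * π * Equiv.swap 0 1, ?_, ?_⟩
    · rw [Equiv.Perm.sign_mul, Equiv.Perm.sign_mul, hπ, mul_one, Int.units_mul_self]
    · rw [OrderedSimplex.perm_perm, OrderedSimplex.perm_perm]
      simp [← mul_assoc]) τ

theorem flip_oriented (s : OrderedSimplex K (p + 1)) :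
    s.oriented.flip = (s.perm (Equiv.swap 0 1)).oriented := rfl

@[simp]
theorem support_flip (τ : OrientedSimplex K (p + 1)) : τ.flip.support = τ.support := by
  obtain ⟨s, rfl⟩ := τ.exists_rep
  exact s.support_perm _

@[simp]
theorem flip_flip (τ : OrientedSimplex K (p + 1)) : τ.flip.flip = τ := by
  obtain ⟨s, rfl⟩ := τ.exists_rep
  rw [flip_oriented, flip_oriented, OrderedSimplex.perm_perm, Equiv.swap_mul_self]
  rfl

theorem flip_ne (τ : OrientedSimplex K (p + 1)) : τ.flip ≠ τ := by
  obtain ⟨s, rfl⟩ := τ.exists_rep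
  rw [flip_oriented, ne_comm, Ne, OrderedSimplex.oriented_eq_iff]
  rintro ⟨π, hπ, h⟩
  have : Equiv.swap 0 1 = π :=
    Equiv.ext fun i => s.injective (congrFun (congrArg OrderedSimplex.vertex h) i)
  rw [← this, Equiv.Perm.sign_swap (by simp)] at hπ
  exact absurd hπ (by decide)

theorem eq_or_eq_flip {τ ρ : OrientedSimplex K (p + 1)} (h : ρ.support = τ.support) :
    ρ = τ ∨ ρ = τ.flip := by
  obtain ⟨s, rfl⟩ := τ.exists_rep
  obtain ⟨t, rfl⟩ := ρ.exists_rep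
  obtain ⟨π, rfl⟩ := OrderedSimplex.exists_perm h.subset
  rcases Int.units_eq_one_or (sign π) with hπ | hπ
  · exact Or.inl (OrderedSimplex.oriented_eq_iff.mpr ⟨π, hπ, rfl⟩).symm
  · refine Or.inr (OrderedSimplex.oriented_eq_iff.mpr ⟨Equiv.swap 0 1 * π, ?_, ?_⟩).symm
    · rw [Equiv.Perm.sign_mul, hπ, Equiv.Perm.sign_swap (by simp), Int.units_mul_self]
    · rw [OrderedSimplex.perm_perm, ← mul_assoc, Equiv.swap_mul_self, one_mul]

theorem sgn_flip {τ : OrientedSimplex K (p + 1)} {μ : OrientedSimplex K p}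
    (h : μ.support ⊆ τ.support) : sgn τ.flip μ = -sgn τ μ := by
  obtain ⟨s, rfl⟩ := τ.exists_rep
  obtain ⟨t, rfl⟩ := μ.exists_rep
  rw [flip_oriented, OrderedSimplex.sgn_perm_left h, Equiv.Perm.sign_swap (by simp)]
  simp

end OrientedSimplex

end Signs

/-! ### The coefficients of the shift -/

section Eta

variable {V : Type*} [DecidableEq V] {K : AbstractSimplicialComplex V} {p : ℕ}

/-- The first vertex of an edge of the down graph. -/
def DownEdge.source (e : DownEdge K p) : OrientedSimplex K (p + 1) := e.1.1

/-- The second vertex of an edge of the down graph. -/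
def DownEdge.target (e : DownEdge K p) : OrientedSimplex K (p + 1) := e.1.2

/-- The edge between two down neighbors. -/
def DownEdge.of {τ τ' : OrientedSimplex K (p + 1)}
    (h : DownNeighbor K p τ.support τ'.support) : DownEdge K p := ⟨(τ, τ'), h⟩

/-- The neighbor given by an element of `AdjTo K p τ`. -/
def AdjTo.target {τ : OrientedSimplex K (p + 1)} (x : AdjTo K p τ) : OrientedSimplex K (p + 1) :=
  x.1

/-- A down neighbor as an element of `AdjTo K p τ`. -/
def AdjTo.of {τ τ' : OrientedSimplex K (p + 1)}
    (h : DownNeighbor K p τ.support τ'.support) : AdjTo K p τ := ⟨τ', h⟩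

theorem AdjTo.ext {τ : OrientedSimplex K (p + 1)} {x y : AdjTo K p τ} (h : x.target = y.target) :
    x = y := Subtype.ext h

theorem AdjTo.downNeighbor {τ : OrientedSimplex K (p + 1)} (x : AdjTo K p τ) :
    DownNeighbor K p τ.support x.target.support := x.2

theorem AdjTo.exists_of {τ : OrientedSimplex K (p + 1)} (x : AdjTo K p τ) :
    ∃ (τ' : OrientedSimplex K (p + 1)) (h : DownNeighbor K p τ.support τ'.support),
      AdjTo.of h = x := ⟨x.1, x.2, rfl⟩

theorem DownEdge.support_common (e : DownEdge K p) :
    e.common.support = e.source.support ∩ e.target.support :=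
  Classical.choose_spec (exists_oriented e.2.1 e.2.2)

theorem eta_eq (e : DownEdge K p) {μ : OrientedSimplex K p}
    (hμ : μ.support = e.source.support ∩ e.target.support) :
    eta e = sgn e.source μ * sgn e.target μ :=
  OrientedSimplex.sgn_mul_sgn (e.support_common.trans hμ.symm)
    (hμ ▸ Finset.inter_subset_left) (hμ ▸ Finset.inter_subset_right)

theorem eta_rev (e : DownEdge K p) : eta e.rev = eta e := by
  rw [eta_eq e.rev (μ := e.common) (by rw [e.support_common, Finset.inter_comm]; rfl), eta,
    mul_comm]
  rfl

theorem eta_mul_self (e : DownEdge K p) : eta e * eta e = 1 := by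
  rw [eta, mul_mul_mul_comm,
    OrientedSimplex.sgn_mul_self (e.support_common ▸ Finset.inter_subset_left),
    OrientedSimplex.sgn_mul_self (e.support_common ▸ Finset.inter_subset_right), one_mul]

open Classical in
/-- The coefficient `η(τ, τ')`, extended by zero to all pairs of oriented simplices. -/
def etaCoeff (τ τ' : OrientedSimplex K (p + 1)) : ℤ :=
  if h : DownNeighbor K p τ.support τ'.support then eta (DownEdge.of h) else 0

theorem etaCoeff_eq {τ τ' : OrientedSimplex K (p + 1)}
    (h : DownNeighbor K p τ.support τ'.support) {μ : OrientedSimplex K p}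
    (hμ : μ.support = τ.support ∩ τ'.support) : etaCoeff τ τ' = sgn τ μ * sgn τ' μ := by
  rw [etaCoeff, dif_pos h]
  exact eta_eq (DownEdge.of h) hμ

theorem eta_edge {τ : OrientedSimplex K (p + 1)} (x : AdjTo K p τ) :
    eta x.edge = etaCoeff τ x.target := by
  rw [etaCoeff, dif_pos x.downNeighbor]
  rfl

theorem etaCoeff_comm (τ τ' : OrientedSimplex K (p + 1)) : etaCoeff τ τ' = etaCoeff τ' τ := by
  by_cases h : DownNeighbor K p τ.support τ'.support
  · rw [etaCoeff, etaCoeff, dif_pos h, dif_pos h.symm, ← eta_rev]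
    rfl
  · rw [etaCoeff, etaCoeff, dif_neg h, dif_neg fun h' => h h'.symm]

theorem etaCoeff_flip_left (τ τ' : OrientedSimplex K (p + 1)) :
    etaCoeff τ.flip τ' = -etaCoeff τ τ' := by
  by_cases h : DownNeighbor K p τ.support τ'.support
  · obtain ⟨μ, hμ⟩ := exists_oriented h.1 h.2
    rw [etaCoeff_eq h hμ, etaCoeff_eq (by rwa [τ.support_flip]) (by rwa [τ.support_flip]),
      OrientedSimplex.sgn_flip (hμ ▸ Finset.inter_subset_left), neg_mul]
  · rw [etaCoeff, etaCoeff, dif_neg h, dif_neg (by rwa [τ.support_flip]), neg_zero]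

theorem etaCoeff_flip_right (τ τ' : OrientedSimplex K (p + 1)) :
    etaCoeff τ τ'.flip = -etaCoeff τ τ' := by
  rw [etaCoeff_comm, etaCoeff_flip_left, etaCoeff_comm]

end Eta

/-! ### Enumeration of the neighbors -/

section Neighbors

variable {V : Type*} [DecidableEq V] {K : AbstractSimplicialComplex V} {p : ℕ}

/-- The family `t` consists of one orientation of each down neighbor of `τ`. -/
structure IsNeighborFamily (τ : OrientedSimplex K (p + 1)) {ι : Type*}
    (t : ι → OrientedSimplex K (p + 1)) : Prop where
  injective : Function.Injective fun i => (t i).support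
  downNeighbor_iff : ∀ τ' : OrientedSimplex K (p + 1),
    DownNeighbor K p τ.support τ'.support ↔ ∃ i, τ'.support = (t i).support

namespace IsNeighborFamily

variable {τ : OrientedSimplex K (p + 1)} {ι : Type*}
  {t : ι → OrientedSimplex K (p + 1)}

theorem comp_equiv {κ : Type*} (ht : IsNeighborFamily τ t) (e : κ ≃ ι) :
    IsNeighborFamily τ (t ∘ e) where
  injective := ht.injective.comp e.injective
  downNeighbor_iff τ' := by
    rw [ht.downNeighbor_iff, ← e.exists_congr_right]
    rfl

theorem downDegree_eq (ht : IsNeighborFamily τ t) : downDegree K p τ = Nat.card ι := by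
  have hrange : {G : Finset V | G ∈ K.faces ∧ G.card = p + 2 ∧ DownNeighbor K p τ.support G}
      = Set.range fun i => (t i).support := by
    ext G
    constructor
    · rintro ⟨hG, hcard, hτG⟩
      obtain ⟨τ', rfl⟩ := exists_oriented hG hcard
      obtain ⟨i, hi⟩ := (ht.downNeighbor_iff τ').mp hτG
      exact ⟨i, hi.symm⟩
    · rintro ⟨i, rfl⟩
      exact ⟨(t i).support_mem, (t i).card_support, (ht.downNeighbor_iff _).mpr ⟨i, rfl⟩⟩
  rw [downDegree, hrange, ← Nat.card_coe_set_eq, Nat.card_range_of_injective ht.injective]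

theorem flip (ht : IsNeighborFamily τ t) : IsNeighborFamily τ.flip t :=
  ⟨ht.injective, fun τ' => by rw [τ.support_flip]; exact ht.downNeighbor_iff τ'⟩

theorem bijective (ht : IsNeighborFamily τ t) : Function.Bijective fun x : ι × Bool =>
    AdjTo.of (τ := τ) (τ' := bif x.2 then (t x.1).flip else t x.1)
      ((ht.downNeighbor_iff _).mpr ⟨x.1, by cases x.2 <;> simp⟩) := by
  constructor
  · rintro ⟨i, b⟩ ⟨j, c⟩ h
    have htarget : (bif b then (t i).flip else t i) = bif c then (t j).flip else t j :=
      congrArg AdjTo.target h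
    obtain rfl : i = j := by
      apply ht.injective
      have := congrArg OrientedSimplex.support htarget
      cases b <;> cases c <;> simpa using this
    cases b <;> cases c
    · rfl
    · exact absurd htarget.symm (t i).flip_ne
    · exact absurd htarget (t i).flip_ne
    · rfl
  · rintro x
    obtain ⟨τ', h, rfl⟩ := x.exists_of
    obtain ⟨i, hi⟩ := (ht.downNeighbor_iff τ').mp h
    rcases OrientedSimplex.eq_or_eq_flip hi with rfl | rfl
    · exact ⟨(i, false), rfl⟩
    · exact ⟨(i, true), rfl⟩

theorem tsum_adjTo [Fintype ι] (ht : IsNeighborFamily τ t) (g : OrientedSimplex K (p + 1) → ℂ) :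
    ∑' x : AdjTo K p τ, g x.target = ∑ i, (g (t i) + g (t i).flip) := by
  rw [← (Equiv.ofBijective _ ht.bijective).tsum_eq, tsum_fintype, Fintype.sum_prod_type]
  refine Finset.sum_congr rfl fun i _ => ?_
  rw [Fintype.sum_bool, add_comm]
  rfl

theorem exists_fin [Fintype ι] {m : ℕ} (ht : IsNeighborFamily τ t) (hm : Fintype.card ι = m) :
    ∃ t' : Fin m → OrientedSimplex K (p + 1), IsNeighborFamily τ t' :=
  ⟨_, ht.comp_equiv (Fintype.equivFinOfCardEq hm).symm⟩

end IsNeighborFamily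

/-- Every `(p + 1)`-simplex has exactly `m` down neighbors. -/
def IsDownRegular (K : AbstractSimplicialComplex V) (p m : ℕ) : Prop :=
  ∀ τ : OrientedSimplex K (p + 1), ∃ t : Fin m → OrientedSimplex K (p + 1), IsNeighborFamily τ t

theorem IsDownRegular.downDegree_eq {m : ℕ} (hK : IsDownRegular K p m)
    (τ : OrientedSimplex K (p + 1)) : downDegree K p τ = m := by
  obtain ⟨t, ht⟩ := hK τ
  rw [ht.downDegree_eq, Nat.card_eq_fintype_card, Fintype.card_fin]

end Neighbors

/-! ### The discriminant of a regular down graph -/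

section Antisymmetric

variable {V : Type*} {K : AbstractSimplicialComplex V} {p : ℕ}

/-- The operator `f ↦ f ∘ flip`. -/
def flipOp (K : AbstractSimplicialComplex V) (p : ℕ) :
    EllTwo (OrientedSimplex K (p + 1)) →L[ℂ] EllTwo (OrientedSimplex K (p + 1)) :=
  pullbackOp OrientedSimplex.flip (Function.Involutive.injective OrientedSimplex.flip_flip)

/-- The orthogonal projection onto the cochains, that is, onto the functions which change sign when
the orientation is reversed. -/
def antisymmProj (K : AbstractSimplicialComplex V) (p : ℕ) :
    EllTwo (OrientedSimplex K (p + 1)) →L[ℂ] EllTwo (OrientedSimplex K (p + 1)) :=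
  (1 / 2 : ℂ) • (1 - flipOp K p)

theorem antisymmProj_apply (f : EllTwo (OrientedSimplex K (p + 1)))
    (τ : OrientedSimplex K (p + 1)) : antisymmProj K p f τ = 1 / 2 * (f τ - f τ.flip) := rfl

theorem antisymmProj_eq_self {f : EllTwo (OrientedSimplex K (p + 1))}
    (hf : ∀ τ, f τ.flip = -f τ) : antisymmProj K p f = f := by
  ext τ
  rw [antisymmProj_apply, hf]
  ring

theorem antisymmProj_antisymmProj (f : EllTwo (OrientedSimplex K (p + 1))) :
    antisymmProj K p (antisymmProj K p f) = antisymmProj K p f :=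
  antisymmProj_eq_self fun τ => by
    rw [antisymmProj_apply, antisymmProj_apply, OrientedSimplex.flip_flip]
    ring

end Antisymmetric

section Formula

variable {V : Type*} [DecidableEq V] {K : AbstractSimplicialComplex V} {p : ℕ}

theorem shiftOp_apply (g : EllTwo (DownEdge K p)) (e : DownEdge K p) :
    shiftOp K p g e = eta e * g e.rev := rfl

theorem adjoint_shiftOp : (shiftOp K p).adjoint = shiftOp K p := by
  refine ((ContinuousLinearMap.eq_adjoint_iff _ _).mpr fun f g => ?_).symm
  let r : DownEdge K p ≃ DownEdge K p := ⟨DownEdge.rev, DownEdge.rev, fun _ => rfl, fun _ => rfl⟩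
  rw [lp.inner_eq_tsum, lp.inner_eq_tsum, ← r.tsum_eq]
  refine tsum_congr fun e => ?_
  change ⟪(eta e.rev : ℂ) * f e, g e.rev⟫_ℂ = ⟪f e, (eta e : ℂ) * g e.rev⟫_ℂ
  rw [eta_rev]
  simp only [RCLike.inner_apply, map_mul, map_intCast]
  ring

theorem shiftOp_shiftOp (g : EllTwo (DownEdge K p)) : shiftOp K p (shiftOp K p g) = g := by
  ext e
  rw [shiftOp_apply, shiftOp_apply, eta_rev, ← mul_assoc, ← Int.cast_mul, eta_mul_self,
    Int.cast_one, one_mul]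
  rfl

/-- The normalizing factor `1 / √(2 deg τ)` of the boundary operator. -/
def boundaryWeight (τ : OrientedSimplex K (p + 1)) : ℝ :=
  1 / Real.sqrt (2 * downDegree K p τ)

theorem boundaryWeight_mul_self {m : ℕ} {τ : OrientedSimplex K (p + 1)}
    (hm : downDegree K p τ = m) :
    (boundaryWeight τ : ℂ) * boundaryWeight τ = 1 / (2 * m) := by
  rw [boundaryWeight, ← Complex.ofReal_mul, div_mul_div_comm, Real.mul_self_sqrt (by positivity),
    hm]
  push_cast
  ring

theorem boundaryOp_apply (g : EllTwo (DownEdge K p)) (τ : OrientedSimplex K (p + 1)) :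
    boundaryOp K p g τ = boundaryWeight τ * ∑' x : AdjTo K p τ, g x.edge := rfl

open Classical in
theorem boundaryOp_single (e : DownEdge K p) :
    boundaryOp K p (lp.single 2 e (1 : ℂ)) =
      lp.single 2 e.source (boundaryWeight e.source : ℂ) := by
  ext τ
  rw [boundaryOp_apply]
  by_cases hτ : τ = e.source
  · subst hτ
    let x : AdjTo K p e.source := AdjTo.of (τ' := e.target) e.2
    have hx : x.edge = e := rfl
    rw [tsum_eq_single x fun y hy => ?_]
    · simp [hx]
    · rw [lp.single_apply, Pi.single_eq_of_ne]
      exact fun he => hy (AdjTo.ext (congrArg DownEdge.target he))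
  · have hzero (x : AdjTo K p τ) : (lp.single 2 e (1 : ℂ) : EllTwo (DownEdge K p)) x.edge = 0 := by
      rw [lp.single_apply, Pi.single_eq_of_ne]
      exact fun he => hτ (congrArg DownEdge.source he)
    rw [tsum_congr hzero, tsum_zero, mul_zero, lp.single_apply, Pi.single_eq_of_ne hτ]

theorem adjoint_boundaryOp_apply (f : EllTwo (OrientedSimplex K (p + 1))) (e : DownEdge K p) :
    (boundaryOp K p).adjoint f e = boundaryWeight e.source * f e.source := by
  classical
  have hcoord : (boundaryOp K p).adjoint f e
      = ⟪lp.single 2 e (1 : ℂ), (boundaryOp K p).adjoint f⟫_ℂ := by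
    rw [lp.inner_single_left]; simp
  rw [hcoord, ContinuousLinearMap.adjoint_inner_right, boundaryOp_single, lp.inner_single_left]
  simp only [RCLike.inner_apply, Complex.conj_ofReal]
  ring

theorem IsDownRegular.isWalkPair {m : ℕ} (hK : IsDownRegular K p m) (hm : m ≠ 0) :
    IsWalkPair (boundaryOp K p) (shiftOp K p) where
  involutive := shiftOp_shiftOp
  selfAdjoint := adjoint_shiftOp
  coisometry f := by
    ext τ
    obtain ⟨t, ht⟩ := hK τ
    have hconst (x : AdjTo K p τ) :
        (boundaryOp K p).adjoint f x.edge = boundaryWeight τ * f τ :=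
      adjoint_boundaryOp_apply f x.edge
    rw [boundaryOp_apply, tsum_congr hconst, ht.tsum_adjTo fun _ => boundaryWeight τ * f τ,
      Finset.sum_const, Finset.card_univ, Fintype.card_fin, nsmul_eq_mul, ← two_mul]
    have hweight := boundaryWeight_mul_self (hK.downDegree_eq τ)
    have hcancel : (1 : ℂ) / (2 * m) * (2 * m) = 1 := by field_simp
    linear_combination (2 * m * f τ) * hweight + f τ * hcancel

theorem downDiscriminant_apply {m : ℕ} (hK : IsDownRegular K p m)
    {τ : OrientedSimplex K (p + 1)} {ι : Type*} [Fintype ι] {t : ι → OrientedSimplex K (p + 1)}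
    (ht : IsNeighborFamily τ t) (f : EllTwo (OrientedSimplex K (p + 1))) :
    downDiscriminant K p f τ
      = 1 / (2 * m) * ∑ i, (etaCoeff τ (t i) : ℂ) * (f (t i) - f (t i).flip) := by
  have hweight (τ' : OrientedSimplex K (p + 1)) : boundaryWeight τ' = boundaryWeight τ := by
    rw [boundaryWeight, boundaryWeight, hK.downDegree_eq, hK.downDegree_eq]
  have hsummand (x : AdjTo K p τ) : shiftOp K p ((boundaryOp K p).adjoint f) x.edge
      = etaCoeff τ x.target * (boundaryWeight τ * f x.target) := by
    rw [shiftOp_apply, eta_edge, adjoint_boundaryOp_apply, hweight]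
    rfl
  rw [downDiscriminant, ContinuousLinearMap.comp_apply, ContinuousLinearMap.comp_apply,
    boundaryOp_apply, tsum_congr hsummand,
    ht.tsum_adjTo fun τ' => (etaCoeff τ τ' : ℂ) * (boundaryWeight τ * f τ'),
    ← boundaryWeight_mul_self (hK.downDegree_eq τ), mul_assoc]
  congr 1
  rw [Finset.mul_sum]
  refine Finset.sum_congr rfl fun i _ => ?_
  rw [etaCoeff_flip_right]
  push_cast
  ring

theorem downDiscriminant_apply_flip {m : ℕ} (hK : IsDownRegular K p m)
    (τ : OrientedSimplex K (p + 1)) (f : EllTwo (OrientedSimplex K (p + 1))) :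
    downDiscriminant K p f τ.flip = -downDiscriminant K p f τ := by
  obtain ⟨t, ht⟩ := hK τ
  rw [downDiscriminant_apply hK ht, downDiscriminant_apply hK ht.flip]
  simp only [etaCoeff_flip_left, Int.cast_neg, neg_mul, Finset.sum_neg_distrib, mul_neg]

theorem downDiscriminant_antisymmProj {m : ℕ} (hK : IsDownRegular K p m)
    (f : EllTwo (OrientedSimplex K (p + 1))) :
    downDiscriminant K p (antisymmProj K p f) = downDiscriminant K p f := by
  ext τ
  obtain ⟨t, ht⟩ := hK τ
  rw [downDiscriminant_apply hK ht, downDiscriminant_apply hK ht]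
  congr 1
  refine Finset.sum_congr rfl fun i _ => ?_
  rw [antisymmProj_apply, antisymmProj_apply, OrientedSimplex.flip_flip]
  ring

theorem zero_mem_pointSpectrum_downDiscriminant {m : ℕ} (hK : IsDownRegular K p m)
    [Nonempty (OrientedSimplex K (p + 1))] : 0 ∈ pointSpectrum (downDiscriminant K p) := by
  classical
  obtain ⟨τ₀⟩ := ‹Nonempty (OrientedSimplex K (p + 1))›
  let f : EllTwo (OrientedSimplex K (p + 1)) := lp.single 2 τ₀ 1
  refine mem_pointSpectrum.mpr ⟨f - antisymmProj K p f, fun h => ?_, ?_⟩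
  · have hτ₀ : f τ₀ = antisymmProj K p f τ₀ := by rw [← sub_eq_zero.mp h]
    rw [antisymmProj_apply, lp.single_apply_self, lp.single_apply,
      Pi.single_eq_of_ne τ₀.flip_ne] at hτ₀
    norm_num at hτ₀
  · rw [map_sub, downDiscriminant_antisymmProj hK, sub_self, zero_smul]

end Formula

/-! ### The edges of the cylinder -/

section Edges

theorem ne_zero_of_mem_adjVec {δ : ZMod 3 × ℤ} (h : δ ∈ adjVec) : δ ≠ 0 := by
  rintro rfl
  revert h
  decide

/-- The opposite difference vector. -/
def negVec (δ : adjVec) : adjVec := ⟨-δ, neg_mem_adjVec δ.2⟩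

theorem pair_mem_cylinder (v : ZMod 3 × ℤ) (δ : adjVec) : {v, v + ↑δ} ∈ cylinder.faces := by
  obtain ⟨l, n⟩ := v
  obtain ⟨δ, hδ⟩ := δ
  refine ⟨by simp, ?_⟩
  simp only [adjVec, Finset.mem_insert, Finset.mem_singleton] at hδ
  rcases hδ with rfl | rfl | rfl | rfl | rfl | rfl
  · exact ⟨l, n, Or.inr (by simp [sigmaTriangle, Finset.insert_subset_iff])⟩
  · exact ⟨l - 1, n, Or.inr (by simp [sigmaTriangle, Finset.insert_subset_iff, sub_eq_add_neg])⟩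
  · exact ⟨l, n, Or.inl (by simp [rhoTriangle, Finset.insert_subset_iff])⟩
  · exact ⟨l, n - 1, Or.inl (by simp [rhoTriangle, Finset.insert_subset_iff, sub_eq_add_neg])⟩
  · exact ⟨l, n, Or.inl (by simp [rhoTriangle, Finset.insert_subset_iff])⟩
  · exact ⟨l - 1, n - 1,
      Or.inl (by simp [rhoTriangle, Finset.insert_subset_iff, sub_eq_add_neg])⟩

theorem sub_mem_adjVec {a b : ZMod 3 × ℤ} (hab : a ≠ b) {F : Finset (ZMod 3 × ℤ)}
    (hF : F ∈ cylinder.faces) (ha : a ∈ F) (hb : b ∈ F) : b - a ∈ adjVec := by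
  obtain ⟨-, l, n, h | h⟩ := hF
  all_goals
    have ha' := h ha
    have hb' := h hb
    simp only [rhoTriangle, sigmaTriangle, Finset.mem_insert, Finset.mem_singleton] at ha' hb'
    rcases ha' with rfl | rfl | rfl <;> rcases hb' with rfl | rfl | rfl <;>
      first
        | exact absurd rfl hab
        | simp [adjVec]

theorem OrderedSimplex.map_mem {V : Type*} {K : AbstractSimplicialComplex V} {q : ℕ}
    {a : Fin (q + 1) → V} {ha : Function.Injective a} {F : Finset V} (hF : F ∈ K.faces)
    (h : ∀ w, w ∈ F ↔ ∃ i, a i = w) : Finset.univ.map ⟨a, ha⟩ ∈ K.faces := by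
  convert hF
  ext w
  simp [h]

/-- A vertex as a `0`-simplex. -/
def orderedVertex (v : ZMod 3 × ℤ) : OrderedSimplex cylinder 0 where
  vertex := fun _ => v
  injective := fun i j _ => Subsingleton.elim (α := Fin 1) i j
  mem := by
    refine OrderedSimplex.map_mem (cylinder.singleton_mem v) fun w => ?_
    rw [Finset.mem_singleton, eq_comm]
    exact ⟨fun h => ⟨0, h⟩, fun ⟨_, h⟩ => h⟩

theorem support_orderedVertex (v : ZMod 3 × ℤ) : (orderedVertex v).oriented.support = {v} := by
  ext w
  rw [OrderedSimplex.support_oriented, OrderedSimplex.mem_support]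
  simp [orderedVertex, eq_comm]

/-- The ordered edge from `v` to `v + δ`. -/
def orderedEdge (v : ZMod 3 × ℤ) (δ : adjVec) : OrderedSimplex cylinder (0 + 1) where
  vertex := ![v, v + δ]
  injective := by
    have hδ := ne_zero_of_mem_adjVec δ.2
    intro i j hij
    fin_cases i <;> fin_cases j <;> simp_all
  mem := by
    refine OrderedSimplex.map_mem (pair_mem_cylinder v δ) fun w => ?_
    rw [Fin.exists_fin_two, Finset.mem_insert, Finset.mem_singleton, eq_comm, @eq_comm _ w]
    rfl

/-- The oriented edge from `v` to `v + δ`. -/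
def edge (v : ZMod 3 × ℤ) (δ : adjVec) : OrientedSimplex cylinder (0 + 1) :=
  (orderedEdge v δ).oriented

instance : Nonempty (OrientedSimplex cylinder (0 + 1)) := ⟨edge 0 ⟨(1, 0), by decide⟩⟩

theorem support_edge (v : ZMod 3 × ℤ) (δ : adjVec) : (edge v δ).support = {v, v + ↑δ} := by
  ext w
  rw [edge, OrderedSimplex.support_oriented, OrderedSimplex.mem_support]
  simp [orderedEdge, Fin.exists_fin_two, eq_comm]

theorem flip_edge (v : ZMod 3 × ℤ) (δ : adjVec) : (edge v δ).flip = edge (v + δ) (negVec δ) := by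
  rw [edge, OrientedSimplex.flip_oriented]
  refine congrArg OrderedSimplex.oriented (OrderedSimplex.ext_vertex (funext fun i => ?_))
  fin_cases i <;> simp [OrderedSimplex.perm, orderedEdge, negVec]

theorem exists_eq_edge (τ : OrientedSimplex cylinder (0 + 1)) : ∃ v δ, τ = edge v δ := by
  obtain ⟨s, rfl⟩ := τ.exists_rep
  have hne : s.vertex 0 ≠ s.vertex 1 := fun h => by simpa using s.injective h
  refine ⟨s.vertex 0, ⟨s.vertex 1 - s.vertex 0, sub_mem_adjVec hne s.mem ?_ ?_⟩, ?_⟩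
  · exact (s.mem_support _).mpr ⟨0, rfl⟩
  · exact (s.mem_support _).mpr ⟨1, rfl⟩
  · refine congrArg OrderedSimplex.oriented (OrderedSimplex.ext_vertex (funext fun i => ?_))
    fin_cases i <;> simp [orderedEdge]

theorem exists_support_eq_support_edge {τ : OrientedSimplex cylinder (0 + 1)} {v : ZMod 3 × ℤ}
    (hv : v ∈ τ.support) : ∃ δ, τ.support = (edge v δ).support := by
  obtain ⟨w, δ, rfl⟩ := exists_eq_edge τ
  rw [support_edge, Finset.mem_insert, Finset.mem_singleton] at hv
  rcases hv with rfl | rfl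
  · exact ⟨δ, rfl⟩
  · exact ⟨negVec δ, by rw [← flip_edge, OrientedSimplex.support_flip]⟩

theorem support_edge_inj {v : ZMod 3 × ℤ} {δ ε : adjVec} :
    (edge v δ).support = (edge v ε).support ↔ δ = ε := by
  refine ⟨fun h => ?_, fun h => h ▸ rfl⟩
  have hmem : v + ↑δ ∈ (edge v ε).support := h ▸ by simp [support_edge]
  simp only [support_edge, Finset.mem_insert, Finset.mem_singleton, add_eq_left,
    ne_zero_of_mem_adjVec δ.2, false_or] at hmem
  exact Subtype.ext (add_left_cancel hmem)

theorem edge_inj {v w : ZMod 3 × ℤ} {δ ε : adjVec} : edge v δ = edge w ε ↔ v = w ∧ δ = ε := by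
  constructor
  · intro h
    obtain ⟨π, hπ, hvertex⟩ := OrderedSimplex.oriented_eq_iff.mp h
    have hone : ∀ π : Equiv.Perm (Fin 2), sign π = 1 → π = 1 := by decide
    obtain rfl := hone π hπ
    obtain rfl : w = v := congrFun (congrArg OrderedSimplex.vertex hvertex) 0
    exact ⟨rfl, support_edge_inj.mp (congrArg OrientedSimplex.support h)⟩
  · rintro ⟨rfl, rfl⟩
    rfl

theorem edge_left_injective (δ : adjVec) : Function.Injective fun v => edge v δ :=
  fun _ _ h => (edge_inj.mp h).1

theorem sgn_edge_left (v : ZMod 3 × ℤ) (δ : adjVec) :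
    sgn (edge v δ) (orderedVertex v).oriented = -1 := by
  rw [edge, OrderedSimplex.sgn_eq_of_vertex 1 1 fun i => ?_]
  · simp
  · fin_cases i
    simp [orderedVertex, orderedEdge]

theorem sgn_edge_right (v : ZMod 3 × ℤ) (δ : adjVec) :
    sgn (edge v δ) (orderedVertex (v + δ)).oriented = 1 := by
  rw [edge, OrderedSimplex.sgn_eq_of_vertex 0 1 fun i => ?_]
  · simp
  · fin_cases i
    simp [orderedVertex, orderedEdge]

/-- The edges which share exactly one vertex with `edge v δ`, oriented away from that vertex. -/
def edgeNeighbor (v : ZMod 3 × ℤ) (δ : adjVec) :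
    {ε : adjVec // ε ≠ negVec δ} ⊕ {ε : adjVec // ε ≠ δ} → OrientedSimplex cylinder (0 + 1) :=
  Sum.elim (fun ε => edge (v + δ) ε) (fun ε => edge v ε)

theorem inter_edge_left (v : ZMod 3 × ℤ) {δ ε : adjVec} (hε : ε ≠ δ) :
    (edge v δ).support ∩ (edge v ε).support = {v} := by
  have hne : v + ↑δ ≠ v + ↑ε := fun h => hε (Subtype.ext (add_left_cancel h).symm)
  rw [support_edge, support_edge, ← Finset.insert_inter_distrib,
    Finset.singleton_inter_of_notMem (Finset.notMem_singleton.mpr hne)]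
  rfl

theorem inter_edge_right (v : ZMod 3 × ℤ) {δ ε : adjVec} (hε : ε ≠ negVec δ) :
    (edge v δ).support ∩ (edge (v + δ) ε).support = {v + ↑δ} := by
  rw [← OrientedSimplex.support_flip (edge v δ), flip_edge, inter_edge_left _ hε]

theorem injective_support_edgeNeighbor (v : ZMod 3 × ℤ) (δ : adjVec) :
    Function.Injective fun i => (edgeNeighbor v δ i).support := by
  have hne (a : {ε : adjVec // ε ≠ negVec δ}) (b : {ε : adjVec // ε ≠ δ}) :
      (edge (v + δ) a).support ≠ (edge v b).support := by
    intro h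
    have hinter := inter_edge_right v a.2
    rw [h, inter_edge_left v b.2, Finset.singleton_inj, left_eq_add] at hinter
    exact ne_zero_of_mem_adjVec δ.2 hinter
  rintro (a | a) (b | b) h
  · exact congrArg _ (Subtype.ext (support_edge_inj.mp h))
  · exact absurd h (hne a b)
  · exact absurd h.symm (hne b a)
  · exact congrArg _ (Subtype.ext (support_edge_inj.mp h))

theorem isNeighborFamily_edge (v : ZMod 3 × ℤ) (δ : adjVec) :
    IsNeighborFamily (edge v δ) (edgeNeighbor v δ) where
  injective := injective_support_edgeNeighbor v δ
  downNeighbor_iff τ' := by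
    constructor
    · rintro ⟨-, hcard⟩
      replace hcard : ((edge v δ).support ∩ τ'.support).card = 1 := hcard
      have hne : (edge v δ).support ≠ τ'.support := by
        intro h
        rw [h, Finset.inter_self, OrientedSimplex.card_support] at hcard
        omega
      obtain ⟨x, hx⟩ := Finset.card_pos.mp (hcard.symm ▸ Nat.one_pos)
      obtain ⟨hxδ, hxτ⟩ := Finset.mem_inter.mp hx
      obtain ⟨ε, hε⟩ := exists_support_eq_support_edge hxτ
      rw [support_edge, Finset.mem_insert, Finset.mem_singleton] at hxδ
      rcases hxδ with rfl | rfl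
      · exact ⟨Sum.inr ⟨ε, by rintro rfl; exact hne hε.symm⟩, hε⟩
      · refine ⟨Sum.inl ⟨ε, ?_⟩, hε⟩
        rintro rfl
        exact hne (by rw [hε, ← flip_edge, OrientedSimplex.support_flip])
    · rintro ⟨ε | ε, h⟩
      · rw [DownNeighbor, h, edgeNeighbor, Sum.elim_inl, inter_edge_right v ε.2]
        exact ⟨cylinder.singleton_mem _, rfl⟩
      · rw [DownNeighbor, h, edgeNeighbor, Sum.elim_inr, inter_edge_left v ε.2]
        exact ⟨cylinder.singleton_mem _, rfl⟩

theorem isDownRegular_edges : IsDownRegular cylinder 0 10 := by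
  intro τ
  obtain ⟨v, δ, rfl⟩ := exists_eq_edge τ
  refine (isNeighborFamily_edge v δ).exists_fin ?_
  rw [Fintype.card_sum, Fintype.card_subtype_compl, Fintype.card_subtype_compl,
    Fintype.card_subtype_eq, Fintype.card_subtype_eq, Fintype.card_coe]
  rfl

theorem isWalkPair_edges : IsWalkPair (boundaryOp cylinder 0) (shiftOp cylinder 0) :=
  isDownRegular_edges.isWalkPair (by norm_num)

theorem etaCoeff_edge_right (v : ZMod 3 × ℤ) {δ ε : adjVec} (hε : ε ≠ negVec δ) :
    etaCoeff (edge v δ) (edge (v + δ) ε) = -1 := by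
  have hneighbor : DownNeighbor cylinder 0 (edge v δ).support (edge (v + δ) ε).support :=
    ((isNeighborFamily_edge v δ).downNeighbor_iff _).mpr ⟨Sum.inl ⟨ε, hε⟩, rfl⟩
  rw [etaCoeff_eq (μ := (orderedVertex (v + δ)).oriented) hneighbor
    (by rw [support_orderedVertex, inter_edge_right v hε]), sgn_edge_right, sgn_edge_left, one_mul]

theorem etaCoeff_edge_left (v : ZMod 3 × ℤ) {δ ε : adjVec} (hε : ε ≠ δ) :
    etaCoeff (edge v δ) (edge v ε) = 1 := by
  have hneighbor : DownNeighbor cylinder 0 (edge v δ).support (edge v ε).support :=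
    ((isNeighborFamily_edge v δ).downNeighbor_iff _).mpr ⟨Sum.inr ⟨ε, hε⟩, rfl⟩
  rw [etaCoeff_eq (μ := (orderedVertex v).oriented) hneighbor
    (by rw [support_orderedVertex, inter_edge_left v hε]), sgn_edge_left, sgn_edge_left]
  rfl

end Edges

/-! ### The discriminant on the edges -/

section EdgeDiscriminant

/-- The boundary operator from functions on the edges to functions on the vertices. -/
def vertexBoundary : EllTwo (OrientedSimplex cylinder (0 + 1)) →L[ℂ] EllTwo (ZMod 3 × ℤ) :=
  -∑ δ : adjVec, pullbackOp (fun v => edge v δ) (edge_left_injective δ) ∘L (1 - flipOp cylinder 0)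

theorem vertexBoundary_apply (f : EllTwo (OrientedSimplex cylinder (0 + 1))) (v : ZMod 3 × ℤ) :
    vertexBoundary f v = -∑ δ : adjVec, (f (edge v δ) - f (edge v δ).flip) := by
  rw [vertexBoundary, _root_.neg_apply, _root_.sum_apply, lp.coeFn_neg, Pi.neg_apply,
    lp.coeFn_sum, Finset.sum_apply]
  rfl

theorem vertexBoundary_single [DecidableEq (OrientedSimplex cylinder (0 + 1))]
    (v : ZMod 3 × ℤ) (δ : adjVec) :
    vertexBoundary (lp.single 2 (edge v δ) 1) = lp.single 2 (v + ↑δ) 1 - lp.single 2 v 1 := by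
  ext w
  have hflip (ε : adjVec) : (edge w ε).flip = edge v δ ↔ w = v + δ ∧ ε = negVec δ := by
    rw [← edge_inj, ← flip_edge, Function.Involutive.eq_iff OrientedSimplex.flip_flip]
  rw [vertexBoundary_apply, lp.coeFn_sub, Pi.sub_apply]
  simp only [lp.single_apply, Pi.single_apply, hflip, edge_inj, ite_and, Finset.sum_sub_distrib]
  split_ifs <;> simp

theorem adjoint_vertexBoundary_apply (u : EllTwo (ZMod 3 × ℤ)) (v : ZMod 3 × ℤ) (δ : adjVec) :
    vertexBoundary.adjoint u (edge v δ) = u (v + δ) - u v := by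
  classical
  have hcoord : vertexBoundary.adjoint u (edge v δ)
      = ⟪lp.single 2 (edge v δ) (1 : ℂ), vertexBoundary.adjoint u⟫_ℂ := by
    rw [lp.inner_single_left]; simp
  rw [hcoord, ContinuousLinearMap.adjoint_inner_right, vertexBoundary_single, inner_sub_left,
    lp.inner_single_left, lp.inner_single_left]
  simp

theorem vertexBoundary_antisymmProj (f : EllTwo (OrientedSimplex cylinder (0 + 1))) :
    vertexBoundary (antisymmProj cylinder 0 f) = vertexBoundary f := by
  ext v
  rw [vertexBoundary_apply, vertexBoundary_apply]
  refine congrArg _ (Finset.sum_congr rfl fun δ _ => ?_)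
  rw [antisymmProj_apply, antisymmProj_apply, OrientedSimplex.flip_flip]
  ring

theorem adjoint_vertexBoundary_flip (u : EllTwo (ZMod 3 × ℤ))
    (τ : OrientedSimplex cylinder (0 + 1)) :
    vertexBoundary.adjoint u τ.flip = -vertexBoundary.adjoint u τ := by
  obtain ⟨v, δ, rfl⟩ := exists_eq_edge τ
  rw [flip_edge, adjoint_vertexBoundary_apply, adjoint_vertexBoundary_apply]
  simp [negVec]

theorem vertexBoundary_adjoint (u : EllTwo (ZMod 3 × ℤ)) :
    vertexBoundary (vertexBoundary.adjoint u) = (18 : ℂ) • u - (2 : ℂ) • latticeOp u := by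
  ext v
  change _ = 18 * u v - 2 * latticeOp u v
  rw [vertexBoundary_apply, latticeOp_apply, ← Finset.sum_coe_sort adjVec fun δ => u (v + δ)]
  have hterm (δ : adjVec) : vertexBoundary.adjoint u (edge v δ)
      - vertexBoundary.adjoint u (edge v δ).flip = 2 * u (v + δ) - 2 * u v := by
    rw [adjoint_vertexBoundary_flip, adjoint_vertexBoundary_apply]
    ring
  have hcard : adjVec.card = 6 := rfl
  rw [Finset.sum_congr rfl fun δ _ => hterm δ, Finset.sum_sub_distrib, Finset.sum_const,
    ← Finset.mul_sum, Finset.card_univ, Fintype.card_coe, hcard]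
  ring

/-- The coboundary operator, normalized as in the discriminant of the 10-regular down graph. -/
def scaledCoboundary : EllTwo (ZMod 3 × ℤ) →L[ℂ] EllTwo (OrientedSimplex cylinder (0 + 1)) :=
  (1 / 20 : ℂ) • vertexBoundary.adjoint

theorem edgeDiscriminant_eq : downDiscriminant cylinder 0 =
    scaledCoboundary ∘L vertexBoundary - (1 / 5 : ℂ) • antisymmProj cylinder 0 := by
  ext f τ
  obtain ⟨v, δ, rfl⟩ := exists_eq_edge τ
  change _ = 1 / 20 * vertexBoundary.adjoint (vertexBoundary f) (edge v δ)
    - 1 / 5 * antisymmProj cylinder 0 f (edge v δ)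
  rw [adjoint_vertexBoundary_apply, antisymmProj_apply,
    downDiscriminant_apply isDownRegular_edges (isNeighborFamily_edge v δ), Fintype.sum_sum_type]
  have hright (ε : {ε : adjVec // ε ≠ negVec δ}) : etaCoeff (edge v δ) (edge (v + δ) ε) = -1 :=
    etaCoeff_edge_right v ε.2
  have hleft (ε : {ε : adjVec // ε ≠ δ}) : etaCoeff (edge v δ) (edge v ε) = 1 :=
    etaCoeff_edge_left v ε.2
  simp only [edgeNeighbor, Sum.elim_inl, Sum.elim_inr, hright, hleft]
  rw [vertexBoundary_apply, vertexBoundary_apply,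
    Fintype.sum_eq_add_sum_subtype_ne _ (negVec δ),
    Fintype.sum_eq_add_sum_subtype_ne (fun ε => f (edge v ε) - f (edge v ε).flip) δ,
    ← flip_edge, OrientedSimplex.flip_flip]
  push_cast
  simp only [neg_mul, one_mul, Finset.sum_neg_distrib]
  ring

theorem antisymmProj_scaledCoboundary (u : EllTwo (ZMod 3 × ℤ)) :
    antisymmProj cylinder 0 (scaledCoboundary u) = scaledCoboundary u := by
  rw [scaledCoboundary, _root_.smul_apply, map_smul,
    antisymmProj_eq_self (adjoint_vertexBoundary_flip u)]

theorem isSelfAdjoint_edgeDiscriminant : IsSelfAdjoint (downDiscriminant cylinder 0) :=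
  isWalkPair_edges.isSelfAdjoint_discriminantOp

/-- The operator on the vertices whose spectral properties pass to the discriminant on the edges. -/
def vertexOp : EllTwo (ZMod 3 × ℤ) →L[ℂ] EllTwo (ZMod 3 × ℤ) :=
  vertexBoundary ∘L scaledCoboundary - (1 / 5 : ℂ) • 1

theorem vertexOp_eq : vertexOp =
    (-1 / 10 : ℂ) • latticeOp + (7 / 10 : ℂ) • (1 : EllTwo (ZMod 3 × ℤ) →L[ℂ] _) := by
  refine ContinuousLinearMap.ext fun u => ?_
  simp only [vertexOp, scaledCoboundary, _root_.sub_apply, _root_.add_apply, _root_.smul_apply,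
    ContinuousLinearMap.coe_comp, Function.comp_apply, one_apply_eq_self, map_smul,
    vertexBoundary_adjoint]
  module

theorem isStarNormal_vertexOp : IsStarNormal vertexOp :=
  vertexOp_eq ▸ isStarNormal_smul_add_smul_one isStarNormal_latticeOp _ _

theorem spectrum_vertexOp :
    spectrum ℂ vertexOp = Complex.ofReal '' Set.Icc (-1 / 5) (7 / 10) := by
  ext x
  have hx : x = -1 / 10 * (7 - 10 * x) + 7 / 10 := by ring
  rw [vertexOp_eq, hx, mul_add_mem_spectrum_iff (by norm_num), spectrum_latticeOp, ← hx]
  constructor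
  · rintro ⟨y, hy, hyx⟩
    exact ⟨7 / 10 - y / 10, ⟨by linarith [hy.2], by linarith [hy.1]⟩,
      by push_cast; linear_combination -hyx / 10⟩
  · rintro ⟨y, hy, rfl⟩
    exact ⟨7 - 10 * y, ⟨by linarith [hy.2], by linarith [hy.1]⟩, by push_cast; ring⟩

theorem pointSpectrum_vertexOp : pointSpectrum vertexOp = ∅ := by
  refine Set.eq_empty_of_forall_notMem fun x => ?_
  have hx : x = -1 / 10 * (7 - 10 * x) + 7 / 10 := by ring
  rw [vertexOp_eq, hx, mul_add_mem_pointSpectrum_iff (by norm_num), pointSpectrum_latticeOp]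
  exact Set.notMem_empty _

theorem dominates_vertexOp {x : ℂ} (hx : x ≠ 0) (hx' : x ≠ ((-1 / 5 : ℝ) : ℂ)) :
    Dominates (vertexOp - x • 1) (downDiscriminant cylinder 0 - x • 1) :=
  edgeDiscriminant_eq ▸ dominates_idempotent_perturbation antisymmProj_antisymmProj
    vertexBoundary_antisymmProj hx fun h => hx' (by rw [h]; push_cast; ring)

theorem dominates_edgeDiscriminant {x : ℂ} (hx : x ≠ ((-1 / 5 : ℝ) : ℂ)) :
    Dominates (downDiscriminant cylinder 0 - x • 1) (vertexOp - x • 1) :=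
  edgeDiscriminant_eq ▸ dominates_of_idempotent_perturbation antisymmProj_scaledCoboundary
    fun h => hx (by rw [h]; push_cast; ring)

theorem neg_one_fifth_mem_pointSpectrum_edgeDiscriminant :
    ((-1 / 5 : ℝ) : ℂ) ∈ pointSpectrum (downDiscriminant cylinder 0) := by
  classical
  let δ : adjVec := ⟨(1, 0), by decide⟩
  let cycle : EllTwo (OrientedSimplex cylinder (0 + 1)) :=
    lp.single 2 (edge (0, 0) δ) 1 + lp.single 2 (edge (1, 0) δ) 1 + lp.single 2 (edge (2, 0) δ) 1
  have hboundary : vertexBoundary cycle = 0 := by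
    have h01 : ((0, 0) : ZMod 3 × ℤ) + δ.1 = (1, 0) := by decide
    have h12 : ((1, 0) : ZMod 3 × ℤ) + δ.1 = (2, 0) := by decide
    have h20 : ((2, 0) : ZMod 3 × ℤ) + δ.1 = (0, 0) := by decide
    simp only [cycle, map_add, vertexBoundary_single, h01, h12, h20]
    abel
  refine mem_pointSpectrum.mpr ⟨antisymmProj cylinder 0 cycle, fun h => ?_, ?_⟩
  · have hvalue : antisymmProj cylinder 0 cycle (edge (0, 0) δ) = 0 := by rw [h]; rfl
    have hne : negVec δ ≠ δ := by decide
    have h02 : (0 : ZMod 3) ≠ 2 := by decide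
    simp [antisymmProj_apply, cycle, flip_edge, edge_inj, hne, h02] at hvalue
  · rw [edgeDiscriminant_eq, _root_.sub_apply, ContinuousLinearMap.comp_apply, _root_.smul_apply,
      vertexBoundary_antisymmProj, hboundary, map_zero, antisymmProj_antisymmProj]
    push_cast
    module

theorem pointSpectrum_edgeDiscriminant :
    pointSpectrum (downDiscriminant cylinder 0) = Complex.ofReal '' {-1 / 5, 0} := by
  rw [Set.image_pair, Complex.ofReal_zero]
  refine Set.Subset.antisymm (fun x hx => ?_) ?_
  · by_contra! hne
    rw [Set.mem_insert_iff, Set.mem_singleton_iff, not_or] at hne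
    have hmem := (dominates_vertexOp hne.2 hne.1).mem_pointSpectrum hx
    rwa [pointSpectrum_vertexOp] at hmem
  · rintro _ (rfl | rfl)
    · exact neg_one_fifth_mem_pointSpectrum_edgeDiscriminant
    · exact zero_mem_pointSpectrum_downDiscriminant isDownRegular_edges

theorem spectrum_edgeDiscriminant :
    spectrum ℂ (downDiscriminant cylinder 0) = Complex.ofReal '' Set.Icc (-1 / 5) (7 / 10) := by
  have hnormal := isSelfAdjoint_edgeDiscriminant.isStarNormal
  ext x
  rw [← spectrum_vertexOp]
  by_cases hx : x ∈ pointSpectrum (downDiscriminant cylinder 0)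
  · refine iff_of_true (pointSpectrum_subset_spectrum _ hx) ?_
    rw [pointSpectrum_edgeDiscriminant] at hx
    rw [spectrum_vertexOp]
    obtain ⟨y, hy, rfl⟩ := hx
    exact ⟨y, by rcases hy with rfl | rfl <;> norm_num, rfl⟩
  · rw [pointSpectrum_edgeDiscriminant, Set.image_pair, Complex.ofReal_zero, Set.mem_insert_iff,
      Set.mem_singleton_iff, not_or] at hx
    exact ⟨(dominates_vertexOp hx.2 hx.1).mem_spectrum isStarNormal_vertexOp hnormal,
      (dominates_edgeDiscriminant hx.1).mem_spectrum hnormal isStarNormal_vertexOp⟩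

theorem Icc_sdiff_pair (a b c : ℝ) : Set.Icc a c \ {a, b} = Set.Ioc a c \ {b} := by
  rw [Set.insert_eq, ← Set.sdiff_sdiff, Set.Icc_sdiff_left]

theorem continuousSpectrum_edgeDiscriminant :
    continuousSpectrum (downDiscriminant cylinder 0)
      = Complex.ofReal '' (Set.Ioc (-1 / 5) (7 / 10) \ {0}) := by
  rw [continuousSpectrum_eq isSelfAdjoint_edgeDiscriminant.isStarNormal,
    spectrum_edgeDiscriminant, pointSpectrum_edgeDiscriminant,
    ← Set.image_sdiff Complex.ofReal_injective, Icc_sdiff_pair]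

theorem not_isClosed_range_edgeDiscriminant :
    ¬IsClosed (Set.range (downDiscriminant cylinder 0)) := by
  have hzero : 0 ∈ continuousSpectrum vertexOp := by
    rw [continuousSpectrum_eq isStarNormal_vertexOp, pointSpectrum_vertexOp, Set.sdiff_empty,
      spectrum_vertexOp]
    exact ⟨0, by norm_num, Complex.ofReal_zero⟩
  have hnot := not_isClosed_range_sub_smul_one hzero
  rw [zero_smul, sub_zero] at hnot
  exact fun h => hnot <| isClosed_range_of_idempotent_perturbation vertexBoundary_antisymmProj
    antisymmProj_scaledCoboundary (by norm_num) (edgeDiscriminant_eq ▸ h)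

end EdgeDiscriminant

/-! ### The triangles of the cylinder -/

section Triangles

/-- The two kinds of triangles at the origin. -/
def baseTriangle (b : Bool) : Finset (ZMod 3 × ℤ) :=
  bif b then {(0, 0), (0, 1), (1, 1)} else {(0, 0), (1, 1), (1, 0)}

/-- The three triangles sharing an edge with `baseTriangle b` are the translates of
`baseTriangle !b` by these vectors. -/
def triShift (b : Bool) : Fin 3 → ZMod 3 × ℤ :=
  bif b then ![(0, 0), (-1, 0), (0, 1)] else ![(0, 0), (1, 0), (0, -1)]

/-- The translate of `baseTriangle b` by `v`. -/
def triangle (b : Bool) (v : ZMod 3 × ℤ) : Finset (ZMod 3 × ℤ) :=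
  (baseTriangle b).map (addRightEmbedding v)

theorem triangle_true (v : ZMod 3 × ℤ) : triangle true v = rhoTriangle v.1 v.2 := by
  obtain ⟨l, n⟩ := v
  simp [triangle, baseTriangle, rhoTriangle, add_comm]

theorem triangle_false (v : ZMod 3 × ℤ) : triangle false v = sigmaTriangle v.1 v.2 := by
  obtain ⟨l, n⟩ := v
  simp [triangle, baseTriangle, sigmaTriangle, add_comm]

theorem triangle_mem_cylinder (b : Bool) (v : ZMod 3 × ℤ) : triangle b v ∈ cylinder.faces := by
  refine ⟨by cases b <;> simp [triangle, baseTriangle], v.1, v.2, ?_⟩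
  cases b
  · exact Or.inr (triangle_false v).subset
  · exact Or.inl (triangle_true v).subset

theorem card_triangle (b : Bool) (v : ZMod 3 × ℤ) : (triangle b v).card = 3 := by
  rw [triangle, Finset.card_map]
  cases b <;> rfl

theorem card_triangle_inter (a b : Bool) (v w : ZMod 3 × ℤ) :
    (triangle a v ∩ triangle b w).card = (baseTriangle a ∩ triangle b (w - v)).card := by
  have h : triangle b w = (triangle b (w - v)).map (addRightEmbedding v) := by
    rw [triangle, triangle, Finset.map_map]
    congr 1
    ext x <;> simp [add_assoc]
  rw [h, triangle, ← Finset.map_inter, Finset.card_map]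

theorem snd_mem_of_baseTriangle_inter {a b : Bool} {d : ZMod 3 × ℤ}
    (h : (baseTriangle a ∩ triangle b d).Nonempty) : d.2 ∈ ({-1, 0, 1} : Finset ℤ) := by
  obtain ⟨x, hx⟩ := h
  obtain ⟨hxa, hxb⟩ := Finset.mem_inter.mp hx
  rw [triangle, Finset.mem_map] at hxb
  obtain ⟨y, hy, rfl⟩ := hxb
  have hheight : ∀ (c : Bool) (z : ZMod 3 × ℤ), z ∈ baseTriangle c → z.2 = 0 ∨ z.2 = 1 := by
    intro c z hz
    cases c <;> simp only [baseTriangle, cond_true, cond_false, Finset.mem_insert,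
      Finset.mem_singleton] at hz <;> rcases hz with rfl | rfl | rfl <;> simp
  have hsum := hheight a _ hxa
  have hsummand := hheight b y hy
  simp only [addRightEmbedding_apply, Prod.snd_add] at hsum
  simp only [Finset.mem_insert, Finset.mem_singleton]
  omega

theorem card_baseTriangle_inter_eq_two_iff :
    ∀ (a b : Bool) (x : ZMod 3), ∀ y ∈ ({-1, 0, 1} : Finset ℤ),
    (baseTriangle a ∩ triangle b (x, y)).card = 2 ↔ b = !a ∧ ∃ i, (x, y) = triShift a i := by
  decide

theorem eq_zero_of_card_baseTriangle_inter_eq_three :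
    ∀ (a b : Bool) (x : ZMod 3), ∀ y ∈ ({-1, 0, 1} : Finset ℤ),
    (baseTriangle a ∩ triangle b (x, y)).card = 3 → b = a ∧ (x, y) = 0 := by
  decide

theorem triShift_injective (a : Bool) : Function.Injective (triShift a) := by
  revert a
  unfold Function.Injective
  decide

theorem triShift_not (a : Bool) (i : Fin 3) : triShift (!a) i = -triShift a i := by
  revert a i
  decide

theorem snd_triShift_mem (a : Bool) (i : Fin 3) : (triShift a i).2 ∈ ({-1, 0, 1} : Finset ℤ) := by
  revert a i
  decide

theorem card_triangle_inter_eq_two {a b : Bool} {v w : ZMod 3 × ℤ} :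
    (triangle a v ∩ triangle b w).card = 2 ↔ b = !a ∧ ∃ i, w = v + triShift a i := by
  rw [card_triangle_inter]
  simp only [← sub_eq_iff_eq_add']
  generalize w - v = d
  obtain ⟨x, y⟩ := d
  constructor
  · intro h
    have hy : (x, y).2 ∈ _ := snd_mem_of_baseTriangle_inter (Finset.card_pos.mp (h ▸ two_pos))
    exact (card_baseTriangle_inter_eq_two_iff a b x y hy).mp h
  · rintro ⟨hb, i, hi⟩
    have hy : (x, y).2 ∈ ({-1, 0, 1} : Finset ℤ) := hi ▸ snd_triShift_mem a i
    exact (card_baseTriangle_inter_eq_two_iff a b x y hy).mpr ⟨hb, i, hi⟩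

theorem triangle_inj {a b : Bool} {v w : ZMod 3 × ℤ} :
    triangle b w = triangle a v ↔ b = a ∧ w = v := by
  constructor
  · intro h
    have hcard : (triangle a v ∩ triangle b w).card = 3 := by
      rw [h, Finset.inter_self, card_triangle]
    rw [card_triangle_inter] at hcard
    have hy := snd_mem_of_baseTriangle_inter (Finset.card_pos.mp (hcard ▸ three_pos))
    obtain ⟨hkind, hshift⟩ :=
      eq_zero_of_card_baseTriangle_inter_eq_three a b (w - v).1 (w - v).2 hy hcard
    exact ⟨hkind, sub_eq_zero.mp hshift⟩
  · rintro ⟨rfl, rfl⟩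
    rfl

theorem exists_eq_triangle {F : Finset (ZMod 3 × ℤ)} (hF : F ∈ cylinder.faces)
    (hc : F.card = 3) : ∃ b v, F = triangle b v := by
  obtain ⟨-, l, n, h | h⟩ := hF
  · refine ⟨true, (l, n), ?_⟩
    rw [← triangle_true (l, n)] at h
    exact Finset.eq_of_subset_of_card_le h (by rw [hc, card_triangle])
  · refine ⟨false, (l, n), ?_⟩
    rw [← triangle_false (l, n)] at h
    exact Finset.eq_of_subset_of_card_le h (by rw [hc, card_triangle])

/-- The vertices of the triangle `triangle b v`, in a coherent order. -/
def triangleVertex (b : Bool) (v : ZMod 3 × ℤ) : Fin 3 → ZMod 3 × ℤ :=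
  bif b then ![v, v + (0, 1), v + (1, 1)] else ![v, v + (1, 1), v + (1, 0)]

theorem mem_triangle_iff (b : Bool) (v w : ZMod 3 × ℤ) :
    w ∈ triangle b v ↔ ∃ i, triangleVertex b v i = w := by
  have h0 : ((0, 0) : ZMod 3 × ℤ) + v = v := zero_add v
  cases b <;>
    simp [triangle, baseTriangle, triangleVertex, Fin.exists_fin_succ, add_comm v, eq_comm, h0]

/-- The triangle `triangle b v` as an ordered simplex. -/
def orderedTriangle (b : Bool) (v : ZMod 3 × ℤ) : OrderedSimplex cylinder (1 + 1) where
  vertex := triangleVertex b v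
  injective := by
    intro i j
    cases b <;> fin_cases i <;> fin_cases j <;> simp [triangleVertex]
  mem := OrderedSimplex.map_mem (triangle_mem_cylinder b v) (mem_triangle_iff b v)

/-- The triangle `triangle b v` with the coherent orientation. -/
def tri (b : Bool) (v : ZMod 3 × ℤ) : OrientedSimplex cylinder (1 + 1) :=
  (orderedTriangle b v).oriented

instance : Nonempty (OrientedSimplex cylinder (1 + 1)) := ⟨tri true 0⟩

@[simp]
theorem support_tri (b : Bool) (v : ZMod 3 × ℤ) : (tri b v).support = triangle b v := by
  ext w
  rw [tri, OrderedSimplex.support_oriented, OrderedSimplex.mem_support, mem_triangle_iff]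
  rfl

theorem exists_tri (τ : OrientedSimplex cylinder (1 + 1)) :
    ∃ b v, τ = tri b v ∨ τ = (tri b v).flip := by
  obtain ⟨b, v, h⟩ := exists_eq_triangle τ.support_mem τ.card_support
  exact ⟨b, v, OrientedSimplex.eq_or_eq_flip (by rw [h, support_tri])⟩

theorem tri_inj {a b : Bool} {v w : ZMod 3 × ℤ} : tri b w = tri a v ↔ b = a ∧ w = v := by
  rw [← triangle_inj, ← support_tri, ← support_tri]
  constructor
  · intro h
    rw [h]
  · intro h
    rw [support_tri, support_tri, triangle_inj] at h
    rw [h.1, h.2]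

theorem flip_tri_ne (a b : Bool) (v w : ZMod 3 × ℤ) : (tri b w).flip ≠ tri a v := by
  intro h
  have hsupport := congrArg OrientedSimplex.support h
  rw [OrientedSimplex.support_flip, support_tri, support_tri, triangle_inj] at hsupport
  obtain ⟨rfl, rfl⟩ := hsupport
  exact (tri b w).flip_ne h

theorem tri_injective (b : Bool) : Function.Injective (tri b) := fun _ _ h => (tri_inj.mp h).2

theorem downNeighbor_iff_card {F G : Finset (ZMod 3 × ℤ)} (hF : F ∈ cylinder.faces) :
    DownNeighbor cylinder 1 F G ↔ (F ∩ G).card = 2 := by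
  refine ⟨fun h => h.2, fun h => ⟨?_, h⟩⟩
  exact (cylinder.isRelLowerSet_faces hF).2 Finset.inter_subset_left
    (Finset.card_pos.mp (h ▸ two_pos))

theorem isNeighborFamily_tri (b : Bool) (v : ZMod 3 × ℤ) :
    IsNeighborFamily (tri b v) fun i => tri (!b) (v + triShift b i) where
  injective := by
    intro i j h
    simp only [support_tri, triangle_inj] at h
    exact triShift_injective b (add_left_cancel h.2)
  downNeighbor_iff := by
    intro τ'
    obtain ⟨c, w, h⟩ := exists_eq_triangle τ'.support_mem τ'.card_support
    rw [h, support_tri, downNeighbor_iff_card (triangle_mem_cylinder b v),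
      card_triangle_inter_eq_two]
    simp only [support_tri, triangle_inj, exists_and_left]

theorem isDownRegular_triangles : IsDownRegular cylinder 1 3 := by
  intro τ
  obtain ⟨b, v, rfl | rfl⟩ := exists_tri τ
  · exact ⟨_, isNeighborFamily_tri b v⟩
  · exact ⟨_, (isNeighborFamily_tri b v).flip⟩

theorem isWalkPair_triangles : IsWalkPair (boundaryOp cylinder 1) (shiftOp cylinder 1) :=
  isDownRegular_triangles.isWalkPair (by norm_num)

theorem etaCoeff_of_faces {V : Type*} [DecidableEq V] {K : AbstractSimplicialComplex V} {p : ℕ}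
    {s s' : OrderedSimplex K (p + 1)} {t : OrderedSimplex K p}
    (hd : DownNeighbor K p s.oriented.support s'.oriented.support)
    (j : Fin (p + 2)) (ρ : Equiv.Perm (Fin (p + 1)))
    (h : ∀ i, t.vertex i = s.vertex (j.succAbove (ρ i)))
    (j' : Fin (p + 2)) (ρ' : Equiv.Perm (Fin (p + 1)))
    (h' : ∀ i, t.vertex i = s'.vertex (j'.succAbove (ρ' i))) :
    etaCoeff s.oriented s'.oriented
      = (sign ρ * (-1) ^ (j : ℕ) : ℤˣ) * (sign ρ' * (-1) ^ (j' : ℕ) : ℤˣ) := by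
  rw [etaCoeff_eq hd (μ := t.oriented), OrderedSimplex.sgn_eq_of_vertex j ρ h,
    OrderedSimplex.sgn_eq_of_vertex j' ρ' h']
  refine Finset.eq_of_subset_of_card_le (fun w hw => ?_) ?_
  · obtain ⟨i, rfl⟩ := (t.mem_support w).mp hw
    exact Finset.mem_inter.mpr ⟨(s.mem_support _).mpr ⟨_, (h i).symm⟩,
      (s'.mem_support _).mpr ⟨_, (h' i).symm⟩⟩
  · rw [hd.2, OrientedSimplex.card_support]

theorem etaCoeff_tri_true (v : ZMod 3 × ℤ) (i : Fin 3) :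
    etaCoeff (tri true v) (tri false (v + triShift true i)) = -1 := by
  have hd : DownNeighbor cylinder 1 (tri true v).support
      (tri false (v + triShift true i)).support :=
    ((isNeighborFamily_tri true v).downNeighbor_iff _).mpr ⟨i, rfl⟩
  obtain ⟨l, n⟩ := v
  fin_cases i
  · refine (etaCoeff_of_faces (t := orderedEdge (l, n) ⟨(1, 1), by decide⟩) hd 1 1 (fun i => ?_)
      2 1 (fun i => ?_)).trans (by simp) <;>
    fin_cases i <;>
    simp [orderedEdge, orderedTriangle, triangleVertex, triShift, Fin.succAbove]
  · refine (etaCoeff_of_faces (t := orderedEdge (l, n) ⟨(0, 1), by decide⟩) hd 2 1 (fun i => ?_)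
      0 (Equiv.swap 0 1) (fun i => ?_)).trans (by simp) <;>
    fin_cases i <;>
    simp [orderedEdge, orderedTriangle, triangleVertex, triShift, Fin.succAbove]
  · refine (etaCoeff_of_faces (t := orderedEdge ((l, n) + (0, 1)) ⟨(1, 0), by decide⟩) hd 0 1
      (fun i => ?_) 1 1 (fun i => ?_)).trans (by simp) <;>
    fin_cases i <;>
    simp [orderedEdge, orderedTriangle, triangleVertex, triShift, Fin.succAbove]

theorem etaCoeff_tri (b : Bool) (v : ZMod 3 × ℤ) (i : Fin 3) :
    etaCoeff (tri b v) (tri (!b) (v + triShift b i)) = -1 := by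
  cases b
  · have heta := etaCoeff_tri_true (v + triShift false i) i
    have hneg : triShift true i = -triShift false i := triShift_not false i
    rwa [hneg, add_neg_cancel_right, etaCoeff_comm] at heta
  · exact etaCoeff_tri_true v i

end Triangles

/-! ### The discriminant on the triangles -/

section TriangleDiscriminant

/-- The antisymmetrized restriction to the triangles of kind `b`. -/
def triRestrict (b : Bool) :
    EllTwo (OrientedSimplex cylinder (1 + 1)) →L[ℂ] EllTwo (ZMod 3 × ℤ) :=
  pullbackOp (tri b) (tri_injective b) ∘L antisymmProj cylinder 1

/-- The antisymmetric extension by zero from the triangles of kind `b`. -/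
def triExtend (b : Bool) :
    EllTwo (ZMod 3 × ℤ) →L[ℂ] EllTwo (OrientedSimplex cylinder (1 + 1)) :=
  antisymmProj cylinder 1 ∘L ((2 : ℂ) • (pullbackOp (tri b) (tri_injective b)).adjoint)

theorem triRestrict_apply (b : Bool) (f : EllTwo (OrientedSimplex cylinder (1 + 1)))
    (v : ZMod 3 × ℤ) : triRestrict b f v = 1 / 2 * (f (tri b v) - f (tri b v).flip) := rfl

theorem triExtend_apply_flip (b : Bool) (u : EllTwo (ZMod 3 × ℤ))
    (τ : OrientedSimplex cylinder (1 + 1)) : triExtend b u τ.flip = -triExtend b u τ := by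
  rw [triExtend, ContinuousLinearMap.comp_apply, antisymmProj_apply, antisymmProj_apply,
    OrientedSimplex.flip_flip]
  ring

theorem triExtend_apply (a b : Bool) (u : EllTwo (ZMod 3 × ℤ)) (v : ZMod 3 × ℤ) :
    triExtend b u (tri a v) = if a = b then u v else 0 := by
  set F := (pullbackOp (tri b) (tri_injective b)).adjoint u with hF
  have hflip : F (tri a v).flip = 0 :=
    adjoint_pullbackOp_apply_of_notMem _ _ fun ⟨w, hw⟩ => flip_tri_ne b a w v hw.symm
  change 1 / 2 * (2 * F (tri a v) - 2 * F (tri a v).flip) = _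
  rw [hflip]
  split_ifs with hab
  · subst hab
    rw [hF, adjoint_pullbackOp_apply]
    ring
  · rw [hF, adjoint_pullbackOp_apply_of_notMem _ _ fun ⟨w, hw⟩ => hab (tri_inj.mp hw).1.symm]
    ring

theorem triRestrict_triExtend (a b : Bool) (u : EllTwo (ZMod 3 × ℤ)) :
    triRestrict a (triExtend b u) = if a = b then u else 0 := by
  ext v
  rw [triRestrict_apply, triExtend_apply_flip, triExtend_apply]
  split_ifs
  · ring
  · rw [neg_zero, sub_zero, mul_zero]
    rfl

theorem isBlockPair_triRestrict :
    IsBlockPair (triRestrict true) (triRestrict false) (triExtend true) (triExtend false) where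
  fst_fst := triRestrict_triExtend true true
  fst_snd := triRestrict_triExtend true false
  snd_fst := triRestrict_triExtend false true
  snd_snd := triRestrict_triExtend false false

theorem triangleDiscriminant_apply (b : Bool) (f : EllTwo (OrientedSimplex cylinder (1 + 1)))
    (v : ZMod 3 × ℤ) : downDiscriminant cylinder 1 f (tri b v)
      = -1 / 3 * ∑ i, triRestrict (!b) f (v + triShift b i) := by
  rw [downDiscriminant_apply isDownRegular_triangles (isNeighborFamily_tri b v)]
  simp only [etaCoeff_tri, triRestrict_apply, ← Finset.mul_sum]
  push_cast
  ring

theorem sum_triShift_true (u : EllTwo (ZMod 3 × ℤ)) (v : ZMod 3 × ℤ) :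
    ∑ i, u (v + triShift true i) = triOp u v := by
  rw [triOp_apply, Fin.sum_univ_three]
  exact congrArg (fun w => u w + _ + _) (add_zero v)

theorem sum_triShift_false (u : EllTwo (ZMod 3 × ℤ)) (v : ZMod 3 × ℤ) :
    ∑ i, u (v + triShift false i) = triOp.adjoint u v := by
  rw [adjoint_triOp_apply, Fin.sum_univ_three]
  exact congrArg (fun w => u w + _ + _) (add_zero v)

theorem triangleDiscriminant_eq : downDiscriminant cylinder 1 =
    offDiagonalOp (triRestrict true) (triRestrict false) (triExtend true) (triExtend false)
      ((-1 / 3 : ℂ) • triOp) ((-1 / 3 : ℂ) • triOp.adjoint) := by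
  refine ContinuousLinearMap.ext fun f => lp.ext (funext fun τ => ?_)
  set g := (-1 / 3 : ℂ) • triOp (triRestrict false f) with hg
  set h := (-1 / 3 : ℂ) • triOp.adjoint (triRestrict true f) with hh
  change downDiscriminant cylinder 1 f τ = triExtend true g τ + triExtend false h τ
  have htri (b : Bool) (v : ZMod 3 × ℤ) :
      downDiscriminant cylinder 1 f (tri b v)
        = triExtend true g (tri b v) + triExtend false h (tri b v) := by
    rw [triangleDiscriminant_apply, triExtend_apply, triExtend_apply]
    cases b
    · simp [sum_triShift_false, hh]
    · simp [sum_triShift_true, hg]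
  obtain ⟨b, v, rfl | rfl⟩ := exists_tri τ
  · exact htri b v
  · rw [downDiscriminant_apply_flip isDownRegular_triangles, htri, triExtend_apply_flip,
      triExtend_apply_flip, neg_add]

theorem isSelfAdjoint_triangleDiscriminant : IsSelfAdjoint (downDiscriminant cylinder 1) :=
  isWalkPair_triangles.isSelfAdjoint_discriminantOp

theorem smul_triOp_comp_smul_adjoint :
    ((-1 / 3 : ℂ) • triOp) ∘L ((-1 / 3 : ℂ) • triOp.adjoint)
      = (1 / 9 : ℂ) • latticeOp + (0 : ℂ) • (1 : EllTwo (ZMod 3 × ℤ) →L[ℂ] _) := by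
  rw [ContinuousLinearMap.comp_smul, ContinuousLinearMap.smul_comp, smul_smul, latticeOp]
  module

theorem dominates_latticeOp {x : ℂ} (hx : x ≠ 0) :
    Dominates ((1 / 9 : ℂ) • latticeOp + (0 : ℂ) • 1 - x ^ 2 • (1 : EllTwo (ZMod 3 × ℤ) →L[ℂ] _))
      (downDiscriminant cylinder 1 - x • 1) :=
  triangleDiscriminant_eq ▸ smul_triOp_comp_smul_adjoint ▸
    isBlockPair_triRestrict.dominates_offDiagonalOp hx

theorem dominates_triangleDiscriminant {x : ℂ} (hx : x ≠ 0) :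
    Dominates (downDiscriminant cylinder 1 - x • 1)
      ((1 / 9 : ℂ) • latticeOp + (0 : ℂ) • 1 - x ^ 2 • (1 : EllTwo (ZMod 3 × ℤ) →L[ℂ] _)) :=
  triangleDiscriminant_eq ▸ smul_triOp_comp_smul_adjoint ▸
    isBlockPair_triRestrict.dominates_comp hx

theorem pointSpectrum_triangleDiscriminant :
    pointSpectrum (downDiscriminant cylinder 1) = {0} := by
  refine Set.Subset.antisymm (fun x hx => ?_) ?_
  · by_contra hne
    have hmem := (dominates_latticeOp hne).mem_pointSpectrum hx
    have hsq : x ^ 2 = 1 / 9 * (9 * x ^ 2) + 0 := by ring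
    rw [hsq, mul_add_mem_pointSpectrum_iff (by norm_num), pointSpectrum_latticeOp] at hmem
    exact hmem
  · rintro _ rfl
    exact zero_mem_pointSpectrum_downDiscriminant isDownRegular_triangles

theorem mem_spectrum_triangleDiscriminant_iff {x : ℂ} (hx : x ≠ 0) :
    x ∈ spectrum ℂ (downDiscriminant cylinder 1) ↔ 9 * x ^ 2 ∈ spectrum ℂ latticeOp := by
  have hlattice : IsStarNormal
      ((1 / 9 : ℂ) • latticeOp + (0 : ℂ) • (1 : EllTwo (ZMod 3 × ℤ) →L[ℂ] _)) :=
    isStarNormal_smul_add_smul_one isStarNormal_latticeOp _ _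
  have hnormal := isSelfAdjoint_triangleDiscriminant.isStarNormal
  have hsq : x ^ 2 = 1 / 9 * (9 * x ^ 2) + 0 := by ring
  rw [← mul_add_mem_spectrum_iff (T := latticeOp) (a := 0) (b := 1 / 9) (by norm_num), ← hsq]
  exact ⟨(dominates_latticeOp hx).mem_spectrum hlattice hnormal,
    (dominates_triangleDiscriminant hx).mem_spectrum hnormal hlattice⟩

theorem spectrum_triangleDiscriminant :
    spectrum ℂ (downDiscriminant cylinder 1) = Complex.ofReal '' Set.Icc (-1) 1 := by
  have hzero : 0 ∈ spectrum ℂ (downDiscriminant cylinder 1) :=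
    pointSpectrum_subset_spectrum _ (pointSpectrum_triangleDiscriminant ▸ rfl)
  have hreal {x : ℝ} (hx : x ≠ 0) :
      (x : ℂ) ∈ spectrum ℂ (downDiscriminant cylinder 1) ↔ x ∈ Set.Icc (-1) 1 := by
    have hcast : 9 * (x : ℂ) ^ 2 = ((9 * x ^ 2 : ℝ) : ℂ) := by push_cast; rfl
    rw [mem_spectrum_triangleDiscriminant_iff (Complex.ofReal_ne_zero.mpr hx),
      spectrum_latticeOp, hcast, Complex.ofReal_injective.mem_set_image, Set.mem_Icc, Set.mem_Icc,
      ← abs_le, ← sq_le_one_iff_abs_le_one]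
    constructor
    · rintro ⟨-, h⟩; linarith
    · intro h; constructor <;> nlinarith [sq_nonneg x]
  have hmem (x : ℝ) : (x : ℂ) ∈ spectrum ℂ (downDiscriminant cylinder 1) ↔ x ∈ Set.Icc (-1) 1 := by
    rcases eq_or_ne x 0 with rfl | hx
    · exact iff_of_true hzero (by norm_num)
    · exact hreal hx
  refine Set.Subset.antisymm (fun x hx => ?_) ?_
  · have hre := isSelfAdjoint_triangleDiscriminant.mem_spectrum_eq_re hx
    exact ⟨x.re, (hmem x.re).mp (hre ▸ hx), hre.symm⟩
  · rintro _ ⟨x, hx, rfl⟩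
    exact (hmem x).mpr hx

theorem continuousSpectrum_triangleDiscriminant :
    continuousSpectrum (downDiscriminant cylinder 1)
      = Complex.ofReal '' (Set.Icc (-1) 1 \ {0}) := by
  rw [continuousSpectrum_eq isSelfAdjoint_triangleDiscriminant.isStarNormal,
    spectrum_triangleDiscriminant, pointSpectrum_triangleDiscriminant,
    Set.image_sdiff Complex.ofReal_injective, Set.image_singleton, Complex.ofReal_zero]

end TriangleDiscriminant

/-! ### The spectra of the walks -/

section WalkSpectra

open Topology

theorem subset_of_sdiff_finite_subset {X : Type*} [TopologicalSpace X] [T1Space X] {C F s : Set X}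
    (hC : Preperfect C) (hF : F.Finite) (hs : IsClosed s) (h : C \ F ⊆ s) : C ⊆ s := by
  intro x hx
  have hnear : ∀ᶠ y in 𝓝 x, y ∉ F \ {x} :=
    (hF.subset Set.sdiff_subset).isClosed.isOpen_compl.mem_nhds fun hxF => hxF.2 rfl
  have hfreq := (accPt_iff_frequently.mp (hC x hx)).and_eventually hnear
  rw [← hs.closure_eq]
  exact mem_closure_iff_frequently.mpr <| hfreq.mono fun y hy =>
    h ⟨hy.1.2, fun hyF => hy.2 ⟨hyF, hy.1.1⟩⟩

theorem preperfect_sphere : Preperfect (Metric.sphere (0 : ℂ) 1) := by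
  have hnontrivial : (Metric.sphere (0 : ℂ) 1).Nontrivial :=
    ⟨1, by simp, -1, by simp, by norm_num⟩
  exact (isPreconnected_sphere (by simp) 0 1).preperfect_of_nontrivial hnontrivial

theorem eq_I_or_eq_neg_I_iff {z : ℂ} : z = Complex.I ∨ z = -Complex.I ↔ ‖z‖ = 1 ∧ z.re = 0 := by
  constructor
  · rintro (rfl | rfl) <;> simp
  · rintro ⟨hz, hre⟩
    have him := Complex.sq_norm z
    rw [hz, Complex.normSq_apply, hre] at him
    refine sq_eq_sq_iff_eq_or_eq_neg.mp ?_
    rw [Complex.I_sq]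
    apply Complex.ext <;> simp [sq, hre]
    linarith

theorem sq_ne_one_of_abs_re_lt_one {z : ℂ} (hz : |z.re| < 1) : z ^ 2 ≠ 1 := by
  intro h
  rcases sq_eq_one_iff.mp h with rfl | rfl <;> simp at hz

theorem mem_spectrum_triangleWalk {z : ℂ} (hz : ‖z‖ = 1) (hz2 : z ^ 2 ≠ 1) :
    z ∈ spectrum ℂ (downGroverWalk cylinder 1) :=
  (isWalkPair_triangles.mem_spectrum_walkOp_iff hz hz2).mpr <|
    spectrum_triangleDiscriminant.superset
      ⟨z.re, abs_le.mp (hz ▸ Complex.abs_re_le_norm z), rfl⟩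

theorem spectrum_triangleWalk :
    spectrum ℂ (downGroverWalk cylinder 1) = Metric.sphere 0 1 := by
  refine Set.Subset.antisymm
    (spectrum.subset_circle_of_unitary isWalkPair_triangles.walkOp_mem_unitary) ?_
  refine subset_of_sdiff_finite_subset (F := {1, -1}) preperfect_sphere (Set.toFinite _)
    (spectrum.isClosed _) fun z hz =>
      mem_spectrum_triangleWalk (mem_sphere_zero_iff_norm.mp hz.1) ?_
  exact fun h => hz.2 (sq_eq_one_iff.mp h)

theorem subset_continuousSpectrum_triangleWalk :
    Metric.sphere 0 1 \ {Complex.I, -Complex.I, 1, -1} ⊆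
      continuousSpectrum (downGroverWalk cylinder 1) := by
  rintro z ⟨hz, hne⟩
  simp only [Set.mem_insert_iff, Set.mem_singleton_iff, ← or_assoc (c := _ ∨ _)] at hne
  obtain ⟨hI, h1⟩ := not_or.mp hne
  replace hz := mem_sphere_zero_iff_norm.mp hz
  refine (isWalkPair_triangles.mem_continuousSpectrum_walkOp_iff hz ?_).mpr ?_
  · exact fun h => h1 (sq_eq_one_iff.mp h)
  · exact continuousSpectrum_triangleDiscriminant.superset
      ⟨z.re, ⟨abs_le.mp (hz ▸ Complex.abs_re_le_norm z),
        fun hre => hI (eq_I_or_eq_neg_I_iff.mpr ⟨hz, hre⟩)⟩, rfl⟩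

theorem subset_pointSpectrum_triangleWalk :
    {Complex.I, -Complex.I} ⊆ pointSpectrum (downGroverWalk cylinder 1) := by
  intro z hz
  obtain ⟨hz, hre⟩ := eq_I_or_eq_neg_I_iff.mp hz
  refine (isWalkPair_triangles.mem_pointSpectrum_walkOp_iff hz
    (sq_ne_one_of_abs_re_lt_one (by simp [hre]))).mpr ?_
  exact pointSpectrum_triangleDiscriminant.superset (by simp [hre])

theorem sq_ne_one_of_re_mem_Icc {z : ℂ} (hre : z.re ∈ Set.Icc (-1 / 5 : ℝ) (7 / 10)) :
    z ^ 2 ≠ 1 :=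
  sq_ne_one_of_abs_re_lt_one (abs_lt.mpr ⟨by linarith [hre.1], by linarith [hre.2]⟩)

theorem mem_spectrum_edgeWalk_iff {z : ℂ} (hz : ‖z‖ = 1) (hz2 : z ^ 2 ≠ 1) :
    z ∈ spectrum ℂ (downGroverWalk cylinder 0) ↔ z.re ∈ Set.Icc (-1 / 5 : ℝ) (7 / 10) := by
  rw [← Complex.ofReal_injective.mem_set_image, ← spectrum_edgeDiscriminant]
  exact isWalkPair_edges.mem_spectrum_walkOp_iff hz hz2

theorem subset_spectrum_edgeWalk :
    {z : ℂ | z ∈ Metric.sphere 0 1 ∧ z.re ∈ Set.Icc (-1 / 5 : ℝ) (7 / 10)} ⊆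
      spectrum ℂ (downGroverWalk cylinder 0) := fun _ ⟨hz, hre⟩ =>
  (mem_spectrum_edgeWalk_iff (mem_sphere_zero_iff_norm.mp hz) (sq_ne_one_of_re_mem_Icc hre)).mpr hre

theorem spectrum_edgeWalk_subset :
    spectrum ℂ (downGroverWalk cylinder 0) ⊆
      {z : ℂ | z ∈ Metric.sphere 0 1 ∧ z.re ∈ Set.Icc (-1 / 5 : ℝ) (7 / 10)} ∪ {1, -1} := by
  intro z hz
  have hsphere := spectrum.subset_circle_of_unitary isWalkPair_edges.walkOp_mem_unitary hz
  by_cases hz2 : z ^ 2 = 1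
  · exact Or.inr (sq_eq_one_iff.mp hz2)
  · exact Or.inl ⟨hsphere,
      (mem_spectrum_edgeWalk_iff (mem_sphere_zero_iff_norm.mp hsphere) hz2).mp hz⟩

theorem subset_continuousSpectrum_edgeWalk :
    {z : ℂ | z ∈ Metric.sphere 0 1 ∧ z.re ∈ (Set.Ioc (-1 / 5) (7 / 10) \ {0} : Set ℝ)} ⊆
      continuousSpectrum (downGroverWalk cylinder 0) := fun _ ⟨hz, hre⟩ =>
  (isWalkPair_edges.mem_continuousSpectrum_walkOp_iff (mem_sphere_zero_iff_norm.mp hz)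
    (sq_ne_one_of_re_mem_Icc (Set.Ioc_subset_Icc_self hre.1))).mpr
      (continuousSpectrum_edgeDiscriminant.superset ⟨_, hre, rfl⟩)

theorem subset_pointSpectrum_edgeWalk :
    {z : ℂ | z ∈ Metric.sphere 0 1 ∧ z.re ∈ ({-1 / 5, 0} : Set ℝ)} ⊆
      pointSpectrum (downGroverWalk cylinder 0) := by
  rintro z ⟨hz, hre⟩
  have hz2 : z ^ 2 ≠ 1 :=
    sq_ne_one_of_re_mem_Icc (by rcases hre with h | h <;> rw [h] <;> norm_num)
  exact (isWalkPair_edges.mem_pointSpectrum_walkOp_iff (mem_sphere_zero_iff_norm.mp hz) hz2).mpr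
    (pointSpectrum_edgeDiscriminant.superset ⟨_, hre, rfl⟩)

theorem not_isClosed_range_edgeWalk {z : ℂ} (hz : z ∈ ({Complex.I, -Complex.I} : Set ℂ)) :
    ¬IsClosed (Set.range fun x => downGroverWalk cylinder 0 x - z • x) := by
  intro hclosed
  obtain ⟨hz, hre⟩ := eq_I_or_eq_neg_I_iff.mp hz
  have hz2 : z ^ 2 ≠ 1 := sq_ne_one_of_abs_re_lt_one (by simp [hre])
  have hdiscriminant := isWalkPair_edges.isClosed_range_discriminantOp hz hz2 hclosed
  rw [hre, Complex.ofReal_zero, zero_smul, sub_zero] at hdiscriminant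
  exact not_isClosed_range_edgeDiscriminant hdiscriminant

theorem pair_union_Ioc {a b c : ℝ} (hb : b ∈ Set.Icc a c) :
    ({a, b} ∪ Set.Ioc a c : Set ℝ) = Set.Icc a c := by
  rw [Set.pair_comm, Set.insert_union, Set.singleton_union, Set.Ioc_insert_left (hb.1.trans hb.2),
    Set.insert_eq_of_mem hb]

end WalkSpectra

end DownWalk

end

theorem proposition5p5 :
    -- the two-dimensional down-discriminant
    (spectrum ℂ (downDiscriminant cylinder 1) =
        Complex.ofReal '' Set.Icc (-1) 1 ∧
      continuousSpectrum (downDiscriminant cylinder 1) =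
        Complex.ofReal '' (Set.Icc (-1) 1 \ {0}) ∧
      pointSpectrum (downDiscriminant cylinder 1) = {0}) ∧
    -- the two-dimensional down-Grover walk
    (spectrum ℂ (downGroverWalk cylinder 1) = Metric.sphere 0 1 ∧
      Metric.sphere 0 1 \ {Complex.I, -Complex.I, 1, -1} ⊆
        continuousSpectrum (downGroverWalk cylinder 1) ∧
      {Complex.I, -Complex.I} ⊆
        pointSpectrum (downGroverWalk cylinder 1)) ∧
    -- the one-dimensional down-discriminant
    (spectrum ℂ (downDiscriminant cylinder 0) =
        Complex.ofReal '' ({-1 / 5, 0} ∪ Set.Ioc (-1 / 5) (7 / 10)) ∧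
      continuousSpectrum (downDiscriminant cylinder 0) =
        Complex.ofReal '' (Set.Ioc (-1 / 5) (7 / 10) \ {0}) ∧
      pointSpectrum (downDiscriminant cylinder 0) =
        Complex.ofReal '' {-1 / 5, 0} ∧
      ¬ IsClosed (Set.range (downDiscriminant cylinder 0))) ∧
    -- the one-dimensional down-Grover walk
    ({z : ℂ | z ∈ Metric.sphere 0 1 ∧ z.re ∈ ({-1 / 5, 0} ∪ Set.Ioc (-1 / 5) (7 / 10) : Set ℝ)} ⊆
        spectrum ℂ (downGroverWalk cylinder 0) ∧
      spectrum ℂ (downGroverWalk cylinder 0) ⊆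
        {z : ℂ | z ∈ Metric.sphere 0 1 ∧
          z.re ∈ ({-1 / 5, 0} ∪ Set.Ioc (-1 / 5) (7 / 10) : Set ℝ)} ∪ {1, -1} ∧
      {z : ℂ | z ∈ Metric.sphere 0 1 ∧ z.re ∈ (Set.Ioc (-1 / 5) (7 / 10) \ {0} : Set ℝ)} ⊆
        continuousSpectrum (downGroverWalk cylinder 0) ∧
      {z : ℂ | z ∈ Metric.sphere 0 1 ∧ z.re ∈ ({-1 / 5, 0} : Set ℝ)} ⊆
        pointSpectrum (downGroverWalk cylinder 0) ∧
      ∀ z ∈ ({Complex.I, -Complex.I} : Set ℂ),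
        ¬ IsClosed (Set.range fun x => downGroverWalk cylinder 0 x - z • x)) := by
  have hIcc : ({-1 / 5, 0} ∪ Set.Ioc (-1 / 5) (7 / 10) : Set ℝ) = Set.Icc (-1 / 5) (7 / 10) :=
    pair_union_Ioc (by norm_num)
  rw [hIcc]
  exact
    ⟨⟨spectrum_triangleDiscriminant, continuousSpectrum_triangleDiscriminant,
        pointSpectrum_triangleDiscriminant⟩,
      ⟨spectrum_triangleWalk, subset_continuousSpectrum_triangleWalk,
        subset_pointSpectrum_triangleWalk⟩,
      ⟨spectrum_edgeDiscriminant, continuousSpectrum_edgeDiscriminant,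
        pointSpectrum_edgeDiscriminant, not_isClosed_range_edgeDiscriminant⟩,
      subset_spectrum_edgeWalk, spectrum_edgeWalk_subset, subset_continuousSpectrum_edgeWalk,
      subset_pointSpectrum_edgeWalk, fun _ hz => not_isClosed_range_edgeWalk hz⟩
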